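/- **Setting and conventions.** All manifolds are smooth, finite-dimensional and without boundary. For a Riemannian manifold $(M,g)$ with Levi-Civita connection $\nabla$ and a smooth vector field $P$ on $M$, put $\pi(X)=g(X,P)$ and let $\overline\nabla_XY=\nabla_XY+\pi(Y)X$ be the associated semi-symmetric non-metric connection. The curvature of a connection $D$ is $R(X,Y)Z=D_XD_YZ-D_YD_XZ-D_{[X,Y]}Z$, and its Ricci tensor is $Ric(X,Y)=\sum_k g(R(X,E_k)Y,E_k)$ for a $g$-orthonormal basis $(E_k)$; $\overline{Ric}$ denotes the Ricci tensor of $\overline\nabla$. For a smooth function $f$, the Hessian is $H^f(X,Y)=XYf-(\nabla_XY)f$ and the Laplacian is $\Delta f=-\operatorname{tr}H^f$. **Proposition 3.1.** Let $(B,g_B)$ and $(F,g_F)$ be Riemannian manifolds of dimensions $n_1$ and $n_2$, put $\overline n=n_1+n_2$, and let $f:B\to(0,\infty)$ be smooth. Let $M=B\times_fF$ be the warped product, i.e. $B\times F$ with the metric $g=g_B\oplus f^2g_F$, and let $P$ be a smooth vector field on $B$, also regarded as a vector field on $M$ by lifting. Suppose that $M$ is quasi-Einstein with respect to $\overline\nabla$: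 there are real numbers $a,b$ and a smooth vector field $U$ on $M$ with $g(U,U)=1$ such that $$\overline{Ric}(X,Y)=a\,g(X,Y)+b\,g(X,U)\,g(Y,U)\quad\text{for all }X,Y\text{ tangent to }M.$$ Let $\overline{Ric}^B$ be the Ricci tensor of the semi-symmetric non-metric connection on $(B,g_B)$ associated with $P$, and $\overline{Ric}^F$ the Ricci tensor of the connection on $(F,g_F)$ associated with the $F$-component of $P$, which is zero (so $\overline{Ric}^F$ is the Ricci tensor of the Levi-Civita connection of $g_F$). Then, at every point $(p,q)\in M$ and for all $X,Y\in T_pB$ and $V,W\in T_qF$ (identified with their lifts to $M$; $\nabla$, $\pi$ are those of $M$, objects with index $B$ or $F$ are those of $(B,g_B)$ or $(F,g_F)$, and $g_B(\cdot,U)$, $g_F(\cdot,U)$ use the $B$- and the $F$-component of $U$): 1) If $U$ is tangent to $B$ (its $F$-component vanishes everywhere), then $$\overline{Ric}^{B}(X,Y)=a\,g_B(X,Y)-n_2\Big[\frac{H^f_B(X,Y)}{f}+g(Y,\nabla_XP)-\pi(X)\pi(Y)\Big]+b\,g_B(X,U)\,g_B(Y,U),$$ $$\overline{Ric}^{F}(V,W)=g_F(V,W)\big[f\Delta_Bf+(1-n_2)|\mathrm{grad}_Bf|_B^2+(1-\overline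 n)fPf+af^2\big].$$ 2) If $U$ is tangent to $F$ (its $B$-component vanishes everywhere), then $$\overline{Ric}^{B}(X,Y)=a\,g_B(X,Y)-n_2\Big[\frac{H^f_B(X,Y)}{f}+g(Y,\nabla_XP)-\pi(X)\pi(Y)\Big],$$ $$\overline{Ric}^{F}(V,W)=g_F(V,W)\big[f\Delta_Bf+(1-n_2)|\mathrm{grad}_Bf|_B^2+(1-\overline n)fPf+af^2\big]+b\,f^4g_F(V,U)\,g_F(W,U).$$ -/

import Mathlib

open scoped Manifold ContDiff

namespace WarpedGeometry

open Bundle VectorField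

set_option linter.unusedSectionVars false

noncomputable section

/-! ## Riemannian metrics and the Levi-Civita connection -/

section Riemannian

variable {E : Type*} [NormedAddCommGroup E] [NormedSpace ℝ E] [FiniteDimensional ℝ E]
  {H : Type*} [TopologicalSpace H] {I : ModelWithCorners ℝ E H}
  {M : Type*} [TopologicalSpace M] [ChartedSpace H M] [IsManifold I ∞ M]

/-- A smooth Riemannian metric on the manifold `M`. -/
abbrev SmoothMetric {E : Type*} [NormedAddCommGroup E] [NormedSpace ℝ E]
    {H : Type*} [TopologicalSpace H] (I : ModelWithCorners ℝ E H)
    (M : Type*) [TopologicalSpace M] [ChartedSpace H M] [IsManifold I ∞ M] :=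
  ContMDiffRiemannianMetric I ∞ E (fun x : M ↦ TangentSpace I x)

/-- Every tangent space has a basis which is orthonormal for the metric. -/
theorem exists_orthonormalFrame (g : SmoothMetric I M) (x : M) :
    ∃ e : Fin (Module.finrank ℝ E) → TangentSpace I x,
      ∀ i j, g.inner x (e i) (e j) = if i = j then 1 else 0 := by
  let c : InnerProductSpace.Core ℝ (TangentSpace I x) := g.toRiemannianMetric.toCore x
  let i1 : NormedAddCommGroup (TangentSpace I x) := c.toNormedAddCommGroup
  let i2 : InnerProductSpace ℝ (TangentSpace I x) := InnerProductSpace.ofCore c.toCore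
  have : FiniteDimensional ℝ (TangentSpace I x) := inferInstanceAs (FiniteDimensional ℝ E)
  let b := (stdOrthonormalBasis ℝ (TangentSpace I x))
  exact ⟨b, fun i j ↦ orthonormal_iff_ite.1 b.orthonormal i j⟩

/-- A `g`-orthonormal basis of the tangent space `T_x M` (an arbitrary choice at each point). -/
def onb (g : SmoothMetric I M) (x : M) : Fin (Module.finrank ℝ E) → TangentSpace I x :=
  (exists_orthonormalFrame g x).choose

theorem onb_inner (g : SmoothMetric I M) (x : M) (i j : Fin (Module.finrank ℝ E)) :
    g.inner x (onb g x i) (onb g x j) = if i = j then 1 else 0 :=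
  (exists_orthonormalFrame g x).choose_spec i j

/-- Expansion of a tangent vector in the chosen orthonormal basis. -/
theorem onb_sum (g : SmoothMetric I M) (x : M) (v : TangentSpace I x) :
    ∑ i, g.inner x v (onb g x i) • onb g x i = v := by
  have hli : LinearIndependent ℝ (onb g x) := by
    rw [Fintype.linearIndependent_iff]
    intro c hc i
    have := congrArg (fun w ↦ g.inner x (onb g x i) w) hc
    simpa [map_sum, onb_inner] using this
  have : FiniteDimensional ℝ (TangentSpace I x) := inferInstanceAs (FiniteDimensional ℝ E)
  have hcard : Fintype.card (Fin (Module.finrank ℝ E)) = Module.finrank ℝ (TangentSpace I x) := by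
    rw [Fintype.card_fin]; rfl
  have hv : v ∈ Submodule.span ℝ (Set.range (onb g x)) := by
    rw [hli.span_eq_top_of_card_eq_finrank' hcard]; trivial
  obtain ⟨c, rfl⟩ := (Submodule.mem_span_range_iff_exists_fun ℝ).1 hv
  simp [map_sum, onb_inner]

/-- The right-hand side of the Koszul formula,
`X g(Y,Z) + Y g(Z,X) - Z g(X,Y) + g([X,Y],Z) - g([X,Z],Y) - g([Y,Z],X)`, at the point `x`. -/
def koszul (g : SmoothMetric I M) (X Y Z : Π x : M, TangentSpace I x) (x : M) : ℝ :=
  mvfderiv I (fun y ↦ g.inner y (Y y) (Z y)) x (X x)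
    + mvfderiv I (fun y ↦ g.inner y (Z y) (X y)) x (Y x)
    - mvfderiv I (fun y ↦ g.inner y (X y) (Y y)) x (Z x)
    + g.inner x (mlieBracket I X Y x) (Z x)
    - g.inner x (mlieBracket I X Z x) (Y x)
    - g.inner x (mlieBracket I Y Z x) (X x)

/-- The function `g(X,Y)` is differentiable where the vector fields `X`, `Y` are. -/
theorem mdiff_inner (g : SmoothMetric I M) {X Y : Π x : M, TangentSpace I x} {x : M}
    (hX : MDiffAt (T% X) x) (hY : MDiffAt (T% Y) x) :
    MDifferentiableAt I 𝓘(ℝ, ℝ) (fun y ↦ g.inner y (X y) (Y y)) x := by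
  have : MDifferentiableAt I (I.prod 𝓘(ℝ)) 
      (fun m ↦ TotalSpace.mk' ℝ (E := Bundle.Trivial M ℝ) m (g.inner m (X m) (Y m))) x := by
    apply MDifferentiableAt.clm_bundle_apply₂ (F₁ := E) (F₂ := E)
    · exact g.contMDiff.mdifferentiableAt (by simp)
    · exact hX
    · exact hY
  rw [mdifferentiableAt_totalSpace] at this
  exact this.2

theorem koszul_add (g : SmoothMetric I M) {X Y Y' Z : Π x : M, TangentSpace I x} {x : M}
    (hX : MDiffAt (T% X) x) (hY : MDiffAt (T% Y) x) (hY' : MDiffAt (T% Y') x)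
    (hZ : MDiffAt (T% Z) x) :
    koszul g X (Y + Y') Z x = koszul g X Y Z x + koszul g X Y' Z x := by
  simp [koszul, mvfderiv_fun_add (mdiff_inner g hX hY) (mdiff_inner g hX hY'), mvfderiv_fun_add (mdiff_inner g hY hZ) (mdiff_inner g hY' hZ), mlieBracket_add_right hY hY', mlieBracket_add_left hY hY']
  ring

theorem koszul_smul (g : SmoothMetric I M) {X Y Z : Π x : M, TangentSpace I x} {φ : M → ℝ}
    {x : M} (hX : MDiffAt (T% X) x) (hY : MDiffAt (T% Y) x) (hφ : MDiffAt φ x)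
    (hZ : MDiffAt (T% Z) x) :
    koszul g X (φ • Y) Z x
      = φ x * koszul g X Y Z x + 2 * mvfderiv I φ x (X x) * g.inner x (Y x) (Z x) := by
  simp [koszul, mvfderiv_fun_mul hφ (mdiff_inner g hX hY), mvfderiv_fun_mul hφ (mdiff_inner g hY hZ), mlieBracket_smul_right hφ hY, mlieBracket_smul_left hφ hY]
  rw [g.symm x (X x) (Y x)]
  ring


/-- The Levi-Civita connection `∇` of `g`. Here `leviCivita g Y x u` is `∇_u Y` at `x` (Mathlib's
argument order). It is read off from the Koszul formula in an orthonormal basis `e` of `T_x M`: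
`∇_u Y = ∑ i, ∑ k, (1/2) K(e_i, Y, e_k) g(e_i, u) e_k`, the vectors `e_i`, `e_k` being extended to
vector fields near `x`. The theorems below show that it satisfies the Koszul formula and is
torsion-free and metric, hence is the usual connection on all differentiable vector fields. -/
def leviCivita (g : SmoothMetric I M) :
    CovariantDerivative I E (TangentSpace I : M → Type _) where
  toFun Y x := ∑ i, ∑ k,
    (koszul g (FiberBundle.extend E (onb g x i)) Y (FiberBundle.extend E (onb g x k)) x / 2) •
      (g.inner x (onb g x i)).smulRight (onb g x k)
  isCovariantDerivativeOnUniv :=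
    { add := by
        intro Y Y' x hY hY' _
        simp only [koszul_add g (FiberBundle.mdifferentiableAt_extend I E _) hY hY'
          (FiberBundle.mdifferentiableAt_extend I E _), add_div, add_smul,
          Finset.sum_add_distrib]
      leibniz := by
        intro Y φ x hY hφ _
        simp only [koszul_smul g (FiberBundle.mdifferentiableAt_extend I E _) hY hφ
          (FiberBundle.mdifferentiableAt_extend I E _), FiberBundle.extend_apply_self, add_div,
          add_smul, Finset.sum_add_distrib, Finset.smul_sum, smul_smul, mul_div_assoc]
        congr 1
        ext w
        have h1 : mvfderiv I φ x w
            = ∑ i, g.inner x w (onb g x i) * mvfderiv I φ x (onb g x i) := by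
          conv_lhs => rw [← onb_sum g x w]
          simp
        have h2 := onb_sum g x (Y x)
        simp only [sum_apply, smul_apply,
          ContinuousLinearMap.smulRight_apply, h1, Finset.sum_smul]
        refine Finset.sum_congr rfl fun i _ ↦ ?_
        conv_rhs => rw [← h2, Finset.smul_sum]
        refine Finset.sum_congr rfl fun k _ ↦ ?_
        rw [smul_smul, smul_smul, g.symm x (onb g x i) w]
        congr 1
        ring }

/-- The Koszul expression is tensorial in its last argument. -/
theorem koszul_tensorial_right (g : SmoothMetric I M) {X Y : Π x : M, TangentSpace I x} {x : M}
    (hX : MDiffAt (T% X) x) (hY : MDiffAt (T% Y) x) :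
    TensorialAt I E (koszul g X Y · x) x where
  smul := by
    intro φ Z hφ hZ
    simp [koszul, mvfderiv_fun_mul hφ (mdiff_inner g hY hZ),
      mvfderiv_fun_mul hφ (mdiff_inner g hZ hX), mlieBracket_smul_right hφ hZ]
    rw [g.symm x (Z x) (X x), g.symm x (Z x) (Y x)]
    ring
  add := by
    intro Z Z' hZ hZ'
    simp [koszul, mvfderiv_fun_add (mdiff_inner g hY hZ) (mdiff_inner g hY hZ'),
      mvfderiv_fun_add (mdiff_inner g hZ hX) (mdiff_inner g hZ' hX), mlieBracket_add_right hZ hZ']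
    ring

/-- The Koszul expression is tensorial in its first argument. -/
theorem koszul_tensorial_left (g : SmoothMetric I M) {Y Z : Π x : M, TangentSpace I x} {x : M}
    (hY : MDiffAt (T% Y) x) (hZ : MDiffAt (T% Z) x) :
    TensorialAt I E (koszul g · Y Z x) x where
  smul := by
    intro φ X hφ hX
    simp [koszul, mvfderiv_fun_mul hφ (mdiff_inner g hX hY),
      mvfderiv_fun_mul hφ (mdiff_inner g hZ hX), mlieBracket_smul_left hφ hX]
    rw [g.symm x (Z x) (X x)]
    ring
  add := by
    intro X X' hX hX'
    simp [koszul, mvfderiv_fun_add (mdiff_inner g hX hY) (mdiff_inner g hX' hY),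
      mvfderiv_fun_add (mdiff_inner g hZ hX) (mdiff_inner g hZ hX'),
      mlieBracket_add_left hX hX']
    ring

/-- The Koszul formula for the Levi-Civita connection. -/
theorem inner_leviCivita (g : SmoothMetric I M) {X Y Z : Π x : M, TangentSpace I x} {x : M}
    (hX : MDiffAt (T% X) x) (hY : MDiffAt (T% Y) x) (hZ : MDiffAt (T% Z) x) :
    2 * g.inner x (leviCivita g Y x (X x)) (Z x) = koszul g X Y Z x := by
  have hl : ∀ W, MDiffAt (T% W) x → TensorialAt I E (koszul g · Y W x) x :=
    fun W hW ↦ koszul_tensorial_left g hY hW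
  have hr : ∀ W, MDiffAt (T% W) x → TensorialAt I E (koszul g W Y · x) x :=
    fun W hW ↦ koszul_tensorial_right g hW hY
  have key := TensorialAt.mkHom₂_apply hl hr hX hZ
  have gen : ∀ u w : TangentSpace I x, 2 * g.inner x (leviCivita g Y x u) w
      = TensorialAt.mkHom₂ (koszul g · Y · x) x hl hr u w := by
    intro u w
    conv_rhs => rw [← onb_sum g x u, ← onb_sum g x w]
    simp only [map_sum, map_smul, sum_apply, smul_apply, TensorialAt.mkHom₂_apply_eq_extend]
    change 2 * g.inner x ((∑ i, ∑ k, (koszul g (FiberBundle.extend E (onb g x i)) Y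
      (FiberBundle.extend E (onb g x k)) x / 2) • (g.inner x (onb g x i)).smulRight
        (onb g x k) : TangentSpace I x →L[ℝ] TangentSpace I x) u) w = _
    simp only [map_sum, map_smul, sum_apply, smul_apply, ContinuousLinearMap.smulRight_apply,
      Finset.mul_sum, smul_eq_mul]
    rw [Finset.sum_comm]
    refine Finset.sum_congr rfl fun k _ ↦ Finset.sum_congr rfl fun i _ ↦ ?_
    rw [g.symm x (onb g x i) u, g.symm x (onb g x k) w]
    ring
  rw [gen, key]

/-- The Levi-Civita connection is torsion-free. -/
theorem leviCivita_torsion (g : SmoothMetric I M) {X Y : Π x : M, TangentSpace I x} {x : M}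
    (hX : MDiffAt (T% X) x) (hY : MDiffAt (T% Y) x) :
    leviCivita g Y x (X x) - leviCivita g X x (Y x) = mlieBracket I X Y x := by
  set D := leviCivita g Y x (X x) - leviCivita g X x (Y x) - mlieBracket I X Y x with hD
  suffices D = 0 from sub_eq_zero.1 this
  by_contra h
  have hZ := FiberBundle.mdifferentiableAt_extend I E D
  have h1 := inner_leviCivita g hX hY hZ
  have h2 := inner_leviCivita g hY hX hZ
  have h3 := g.pos x D h
  simp only [koszul, FiberBundle.extend_apply_self] at h1 h2
  rw [mlieBracket_swap_apply (V := Y)] at h2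
  have e0 : g.inner x D = g.inner x (leviCivita g Y x (X x))
      - g.inner x (leviCivita g X x (Y x)) - g.inner x (mlieBracket I X Y x) := by
    rw [hD, map_sub, map_sub]
  have e1 := congrArg (fun L : TangentSpace I x →L[ℝ] ℝ ↦ L D) e0
  simp only [sub_apply] at e1
  have c1 := fun (A B : Π x : M, TangentSpace I x) ↦ (funext fun y ↦ g.symm y (A y) (B y) :
    (fun y ↦ g.inner y (A y) (B y)) = fun y ↦ g.inner y (B y) (A y))
  rw [c1 Y X, c1 X (FiberBundle.extend E D), c1 (FiberBundle.extend E D) Y] at h2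
  simp at h2
  linarith

/-- The Levi-Civita connection is metric. -/
theorem leviCivita_metric (g : SmoothMetric I M) {X Y Z : Π x : M, TangentSpace I x} {x : M}
    (hX : MDiffAt (T% X) x) (hY : MDiffAt (T% Y) x) (hZ : MDiffAt (T% Z) x) :
    mvfderiv I (fun y ↦ g.inner y (Y y) (Z y)) x (X x)
      = g.inner x (leviCivita g Y x (X x)) (Z x) + g.inner x (Y x) (leviCivita g Z x (X x)) := by
  have h1 := inner_leviCivita g hX hY hZ
  have h2 := inner_leviCivita g hX hZ hY
  rw [g.symm x (Y x)]
  simp only [koszul] at h1 h2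
  have c1 := fun (A B : Π x : M, TangentSpace I x) ↦ (funext fun y ↦ g.symm y (A y) (B y) :
    (fun y ↦ g.inner y (A y) (B y)) = fun y ↦ g.inner y (B y) (A y))
  rw [mlieBracket_swap_apply (V := Z), c1 Z Y, c1 Y X, c1 X Z] at h2
  simp at h2
  linarith

/-! ## Semi-symmetric non-metric connection, curvature, Hessian -/

/-- The curvature `R(X,Y)Z = ∇_X ∇_Y Z - ∇_Y ∇_X Z - ∇_[X,Y] Z` of a connection on `TM`. -/
def curvature (cov : CovariantDerivative I E (TangentSpace I : M → Type _))
    (X Y Z : Π x : M, TangentSpace I x) (x : M) : TangentSpace I x :=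
  cov (fun y ↦ cov Z y (Y y)) x (X x) - cov (fun y ↦ cov Z y (X y)) x (Y x)
    - cov Z x (mlieBracket I X Y x)

/-- The Ricci tensor of a connection `∇` on `TM`, with the convention
`Ric(u,v) = ∑ k, g(R(u,e_k)v, e_k)` for a `g`-orthonormal basis `e` of `T_x M`. The curvature being
tensorial, the tangent vectors are extended to vector fields near `x`. -/
def ricci (g : SmoothMetric I M) (cov : CovariantDerivative I E (TangentSpace I : M → Type _))
    (x : M) (u v : TangentSpace I x) : ℝ :=
  ∑ k, g.inner x
    (curvature cov (FiberBundle.extend E u) (FiberBundle.extend E (onb g x k))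
      (FiberBundle.extend E v) x) (onb g x k)

/-- The semi-symmetric non-metric connection `∇̄_X Y = ∇_X Y + π(Y) X` with `π(Y) = g(Y,P)`,
associated with the vector field `P`. -/
def semiSymmetricConnection (g : SmoothMetric I M) (P : Π x : M, TangentSpace I x) :
    CovariantDerivative I E (TangentSpace I : M → Type _) :=
  (leviCivita g).addOneForm fun x ↦
    (g.inner x (P x)).smulRight (ContinuousLinearMap.id ℝ (TangentSpace I x))

theorem semiSymmetricConnection_apply (g : SmoothMetric I M) (P Y : Π x : M, TangentSpace I x)
    (x : M) (u : TangentSpace I x) :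
    semiSymmetricConnection g P Y x u = leviCivita g Y x u + g.inner x (Y x) (P x) • u := by
  rw [g.symm x (Y x)]; rfl

/-- The gradient of `f`, in an orthonormal basis. -/
def riemannianGradient (g : SmoothMetric I M) (f : M → ℝ) (x : M) : TangentSpace I x :=
  ∑ k, mvfderiv I f x (onb g x k) • onb g x k

theorem inner_gradient (g : SmoothMetric I M) (f : M → ℝ) (x : M) (u : TangentSpace I x) :
    g.inner x (riemannianGradient g f x) u = mvfderiv I f x u := by
  conv_rhs => rw [← onb_sum g x u]
  simp [riemannianGradient, g.symm x u, mul_comm]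

/-- The Hessian `H^f(X,Y) = X(Y f) - (∇_X Y) f`, for tangent vectors `u = X_x`, `v = Y_x`. -/
def hessian (g : SmoothMetric I M) (f : M → ℝ) (x : M) (u v : TangentSpace I x) : ℝ :=
  mvfderiv I (fun y ↦ mvfderiv I f y (FiberBundle.extend E v y)) x u
    - mvfderiv I f x (leviCivita g (FiberBundle.extend E v) x u)

/-- The Laplacian, with the sign convention `Δf = - tr H^f`. -/
def laplacian (g : SmoothMetric I M) (f : M → ℝ) (x : M) : ℝ :=
  -∑ k, hessian g f x (onb g x k) (onb g x k)

/-- The quasi-Einstein condition for the Ricci tensor of the connection `cov` with real scalars `a`,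
`b` and generator `U`: `U` is a unit vector field and `Ric(X,Y) = a g(X,Y) + b A(X) A(Y)`, where
`A(X) = g(X,U)`. -/
structure IsQuasiEinstein (g : SmoothMetric I M)
    (cov : CovariantDerivative I E (TangentSpace I : M → Type _)) (a b : ℝ)
    (U : Π x : M, TangentSpace I x) : Prop where
  contMDiff : ContMDiff I (I.prod 𝓘(ℝ, E)) ∞ (fun x ↦ TotalSpace.mk' E x (U x))
  unit : ∀ x, g.inner x (U x) (U x) = 1
  ricci_eq : ∀ x (u v : TangentSpace I x),
    ricci g cov x u v = a * g.inner x u v + b * (g.inner x u (U x) * g.inner x v (U x))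

/-- A Riemannian metric is nonnegative on the diagonal. -/
theorem metric_self_nonneg (g : SmoothMetric I M) (x : M) (u : TangentSpace I x) :
    0 ≤ g.inner x u u := by
  by_cases h : u = 0
  · simp [h]
  · exact (g.pos _ _ h).le

/-- A family of bilinear forms on the tangent spaces is smooth as soon as its coefficients in the
standard local frames are. -/
theorem contMDiff_bilin_of_apply (ψ : Π x : M, TangentSpace I x →L[ℝ] TangentSpace I x →L[ℝ] ℝ)
    (h : ∀ (x₀ : M) (v w : E), ContMDiffAt I 𝓘(ℝ) ∞ (fun x ↦ ψ x
      ((trivializationAt E (TangentSpace I) x₀).symm x v)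
      ((trivializationAt E (TangentSpace I) x₀).symm x w)) x₀) :
    ContMDiff I (I.prod 𝓘(ℝ, E →L[ℝ] E →L[ℝ] ℝ)) ∞
      (fun x ↦ TotalSpace.mk' (E →L[ℝ] E →L[ℝ] ℝ) x (ψ x)) := by
  intro x₀
  rw [contMDiffAt_hom_bundle]
  refine ⟨contMDiffAt_id, ?_⟩
  let e := Module.finBasis ℝ E
  let ε : Fin (Module.finrank ℝ E) → E →L[ℝ] ℝ := fun i ↦ LinearMap.toContinuousLinearMap (e.coord i)
  have key : ContMDiffAt I 𝓘(ℝ, E →L[ℝ] E →L[ℝ] ℝ) ∞ (fun x ↦ ∑ i, ∑ j,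
    (ψ x ((trivializationAt E (TangentSpace I) x₀).symm x (e i))
      ((trivializationAt E (TangentSpace I) x₀).symm x (e j))) • (ε i).smulRight (ε j)) x₀ := by
    refine contMDiffAt_finsetSum fun i _ ↦ contMDiffAt_finsetSum fun j _ ↦ ?_
    exact (h x₀ (e i) (e j)).smul contMDiffAt_const
  refine key.congr_of_eventuallyEq ?_
  filter_upwards [(trivializationAt E (TangentSpace I) x₀).open_baseSet.mem_nhds
    (FiberBundle.mem_baseSet_trivializationAt' x₀)] with x hx
  ext v w
  rw [inCoordinates_apply_eq₂ hx hx (by trivial)]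
  have hsum : ∀ v : E, (trivializationAt E (TangentSpace I) x₀).symm x v
      = ∑ i, e.coord i v • (trivializationAt E (TangentSpace I) x₀).symm x (e i) := by
    intro v
    have := congrArg (fun z ↦ (trivializationAt E (TangentSpace I) x₀).symmₗ ℝ x z) (e.sum_repr v)
    simp only [map_sum, map_smul] at this
    have e1 := fun z ↦ Trivialization.symmₗ_apply (R := ℝ)
      (trivializationAt E (TangentSpace I : M → Type _) x₀) hx z
    rw [← e1 v]
    exact this.symm.trans (Finset.sum_congr rfl fun i _ ↦ by rw [e1]; rfl)
  rw [hsum v, hsum w]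
  simp [map_sum, ε, Finset.mul_sum]
  rw [Finset.sum_comm]
  exact Finset.sum_congr rfl fun i _ ↦ Finset.sum_congr rfl fun j _ ↦ by ring
end Riemannian

/-! ## Warped products -/

section Warped

variable {EB : Type*} [NormedAddCommGroup EB] [NormedSpace ℝ EB] [FiniteDimensional ℝ EB]
  {HB : Type*} [TopologicalSpace HB] {IB : ModelWithCorners ℝ EB HB}
  {B : Type*} [TopologicalSpace B] [ChartedSpace HB B] [IsManifold IB ∞ B]
  {EF : Type*} [NormedAddCommGroup EF] [NormedSpace ℝ EF] [FiniteDimensional ℝ EF]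
  {HF : Type*} [TopologicalSpace HF] {IF : ModelWithCorners ℝ EF HF}
  {F : Type*} [TopologicalSpace F] [ChartedSpace HF F] [IsManifold IF ∞ F]

variable (IB IF) in
/-- The component along the base of a tangent vector of `B × F`. -/
def basePart (x : B × F) : TangentSpace (IB.prod IF) x →L[ℝ] TangentSpace IB x.1 :=
  ContinuousLinearMap.fst ℝ (TangentSpace IB x.1) (TangentSpace IF x.2)

variable (IB IF) in
/-- The component along the fibre of a tangent vector of `B × F`. -/
def fibrePart (x : B × F) : TangentSpace (IB.prod IF) x →L[ℝ] TangentSpace IF x.2 :=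
  ContinuousLinearMap.snd ℝ (TangentSpace IB x.1) (TangentSpace IF x.2)

variable (IB IF) in
/-- The lift to `B × F` of a tangent vector of the base. -/
def horizontal (x : B × F) : TangentSpace IB x.1 →L[ℝ] TangentSpace (IB.prod IF) x :=
  ContinuousLinearMap.inl ℝ (TangentSpace IB x.1) (TangentSpace IF x.2)

variable (IB IF) in
/-- The lift to `B × F` of a tangent vector of the fibre. -/
def vertical (x : B × F) : TangentSpace IF x.2 →L[ℝ] TangentSpace (IB.prod IF) x :=
  ContinuousLinearMap.inr ℝ (TangentSpace IB x.1) (TangentSpace IF x.2)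

/-- The base component is the differential of the projection to the base. -/
theorem basePart_eq (x : B × F) : basePart IB IF x = mfderiv (IB.prod IF) IB Prod.fst x := by
  rw [mfderiv_fst]; rfl

theorem fibrePart_eq (x : B × F) : fibrePart IB IF x = mfderiv (IB.prod IF) IF Prod.snd x := by
  rw [mfderiv_snd]; rfl

/-- The lift from the base is the differential of the inclusion of the leaf through `x`. -/
theorem horizontal_eq (x : B × F) :
    horizontal IB IF x = mfderiv IB (IB.prod IF) (fun p ↦ (p, x.2)) x.1 := by
  rw [mfderiv_prod_left]; rfl

/-- The lift to `B × F` of a vector field on the base. -/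
def liftBase (P : Π p : B, TangentSpace IB p) (x : B × F) : TangentSpace (IB.prod IF) x :=
  horizontal IB IF x (P x.1)

/-- The bilinear form `g_B ⊕ f² g_F` on the tangent spaces of `B × F`. -/
def warpedInner (gB : SmoothMetric IB B) (gF : SmoothMetric IF F) (f : B → ℝ) (x : B × F) :
    TangentSpace (IB.prod IF) x →L[ℝ] TangentSpace (IB.prod IF) x →L[ℝ] ℝ :=
  ((basePart IB IF x).precomp ℝ).comp ((gB.inner x.1).comp (basePart IB IF x))
    + (f x.1 ^ 2) • ((fibrePart IB IF x).precomp ℝ).comp ((gF.inner x.2).comp (fibrePart IB IF x))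

theorem warpedInner_apply (gB : SmoothMetric IB B) (gF : SmoothMetric IF F) (f : B → ℝ) (x : B × F)
    (u v : TangentSpace (IB.prod IF) x) :
    warpedInner gB gF f x u v = gB.inner x.1 (basePart IB IF x u) (basePart IB IF x v)
      + f x.1 ^ 2 * gF.inner x.2 (fibrePart IB IF x u) (fibrePart IB IF x v) := rfl

/-- The warped product metric `g_B ⊕ f² g_F` on `B × F`. -/
def warpedMetric (gB : SmoothMetric IB B) (gF : SmoothMetric IF F) (f : B → ℝ)
    (hf : ContMDiff IB 𝓘(ℝ) ∞ f) (hpos : ∀ p, 0 < f p) : SmoothMetric (IB.prod IF) (B × F) where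
  inner := warpedInner gB gF f
  symm x v w := by
    simp only [warpedInner_apply]; rw [gB.symm, gF.symm]
  pos x v hv := by
    have hne : basePart IB IF x v ≠ 0 ∨ fibrePart IB IF x v ≠ 0 := by
      by_contra! h
      exact hv (Prod.ext h.1 h.2)
    have h1 : 0 ≤ gB.inner x.1 (basePart IB IF x v) (basePart IB IF x v) := by
      by_cases h : basePart IB IF x v = 0
      · simp [h]
      · exact (gB.pos _ _ h).le
    have h2 : 0 ≤ gF.inner x.2 (fibrePart IB IF x v) (fibrePart IB IF x v) := by
      by_cases h : fibrePart IB IF x v = 0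
      · simp [h]
      · exact (gF.pos _ _ h).le
    have h3 : 0 < f x.1 ^ 2 := pow_pos (hpos _) 2
    rw [warpedInner_apply]
    rcases hne with h | h
    · have := gB.pos _ _ h
      positivity
    · have := gF.pos _ _ h
      positivity
  isVonNBounded x := by
    have h3 : 0 < f x.1 := hpos _
    have b1 : Bornology.IsBounded {u : EB | gB.inner x.1 u u < 1} :=
      (NormedSpace.isVonNBounded_iff ℝ).1 (gB.isVonNBounded x.1)
    have b2 : Bornology.IsBounded {u : EF | gF.inner x.2 u u < 1} :=
      (NormedSpace.isVonNBounded_iff ℝ).1 (gF.isVonNBounded x.2)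
    refine (NormedSpace.isVonNBounded_iff ℝ (E := EB × EF)).2
      ((b1.prod (b2.smul₀ (f x.1)⁻¹)).subset ?_)
    intro v hv
    change gB.inner x.1 v.1 v.1 + f x.1 ^ 2 * gF.inner x.2 v.2 v.2 < 1 at hv
    have n1 := metric_self_nonneg gB x.1 v.1
    have n2 := metric_self_nonneg gF x.2 v.2
    have h4 : 0 < f x.1 ^ 2 := pow_pos h3 2
    refine ⟨by change gB.inner x.1 v.1 v.1 < 1; nlinarith [mul_nonneg h4.le n2], ?_⟩
    refine ⟨f x.1 • v.2, ?_, ?_⟩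
    · change gF.inner x.2 (f x.1 • v.2) (f x.1 • v.2) < 1
      have h5 : ∀ z : TangentSpace IF x.2, gF.inner x.2 (f x.1 • z) (f x.1 • z)
          = f x.1 ^ 2 * gF.inner x.2 z z := fun z ↦ by simp; ring
      exact (h5 v.2).trans_lt (by linarith)
    · simp [smul_smul, h3.ne']
  contMDiff := by
    apply contMDiff_bilin_of_apply
    intro x₀ v w
    have hs : ∀ v : EB × EF, ContMDiffAt (IB.prod IF) ((IB.prod IF).prod 𝓘(ℝ, EB × EF)) ∞
        (fun x ↦ TotalSpace.mk' (EB × EF) x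
          ((trivializationAt (EB × EF) (TangentSpace (IB.prod IF)) x₀).symm x v)) x₀ := by
      intro v
      have := FiberBundle.contMDiffAt_extend (k := ∞) (IB.prod IF) (EB × EF)
        (V := fun x : B × F ↦ TangentSpace (IB.prod IF) x) (x := x₀)
        ((trivializationAt (EB × EF) (TangentSpace (IB.prod IF)) x₀).symm x₀ v)
      have hx := FiberBundle.mem_baseSet_trivializationAt' (F := EB × EF)
        (E := fun x : B × F ↦ TangentSpace (IB.prod IF) x) x₀
      simp only [FiberBundle.extend] at this
      rw [Trivialization.apply_mk_symm _ hx] at this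
      exact this
    have hsB : ∀ v : EB × EF, ContMDiffAt (IB.prod IF) (IB.prod 𝓘(ℝ, EB)) ∞
        (fun x ↦ TotalSpace.mk' EB x.1 (basePart IB IF x
          ((trivializationAt (EB × EF) (TangentSpace (IB.prod IF)) x₀).symm x v))) x₀ := fun v ↦
      ((contMDiff_fst.comp (contMDiff_equivTangentBundleProd (I := IB) (I' := IF) (M := B) (M' := F))).contMDiffAt).comp x₀ (hs v)
    have hsF : ∀ v : EB × EF, ContMDiffAt (IB.prod IF) (IF.prod 𝓘(ℝ, EF)) ∞
        (fun x ↦ TotalSpace.mk' EF x.2 (fibrePart IB IF x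
          ((trivializationAt (EB × EF) (TangentSpace (IB.prod IF)) x₀).symm x v))) x₀ := fun v ↦
      ((contMDiff_snd.comp (contMDiff_equivTangentBundleProd (I := IB) (I' := IF) (M := B) (M' := F))).contMDiffAt).comp x₀ (hs v)
    have hB : ContMDiffAt (IB.prod IF) (IB.prod 𝓘(ℝ)) ∞
        (fun x : B × F ↦ TotalSpace.mk' ℝ (E := Bundle.Trivial B ℝ) x.1 (gB.inner x.1
          (basePart IB IF x
            ((trivializationAt (EB × EF) (TangentSpace (IB.prod IF)) x₀).symm x v))
          (basePart IB IF x
            ((trivializationAt (EB × EF) (TangentSpace (IB.prod IF)) x₀).symm x w)))) x₀ := by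
      apply ContMDiffAt.clm_bundle_apply₂ (F₁ := EB) (F₂ := EB) (b := Prod.fst)
      · exact (gB.contMDiff.contMDiffAt).comp x₀ contMDiffAt_fst
      · exact hsB v
      · exact hsB w
    have hF : ContMDiffAt (IB.prod IF) (IF.prod 𝓘(ℝ)) ∞
        (fun x : B × F ↦ TotalSpace.mk' ℝ (E := Bundle.Trivial F ℝ) x.2 (gF.inner x.2
          (fibrePart IB IF x
            ((trivializationAt (EB × EF) (TangentSpace (IB.prod IF)) x₀).symm x v))
          (fibrePart IB IF x
            ((trivializationAt (EB × EF) (TangentSpace (IB.prod IF)) x₀).symm x w)))) x₀ := by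
      apply ContMDiffAt.clm_bundle_apply₂ (F₁ := EF) (F₂ := EF) (b := Prod.snd)
      · exact (gF.contMDiff.contMDiffAt).comp x₀ contMDiffAt_snd
      · exact hsF v
      · exact hsF w
    rw [contMDiffAt_totalSpace] at hB hF
    have hf' : ContMDiffAt (IB.prod IF) 𝓘(ℝ) ∞ (fun x : B × F ↦ f x.1 ^ 2) x₀ :=
      ((hf.contMDiffAt).comp x₀ contMDiffAt_fst).pow 2
    exact hB.2.add (hf'.mul hF.2)

end Warped

end

end WarpedGeometry

open WarpedGeometry

open scoped Manifold ContDiff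

namespace WarpedGeometry

open Bundle VectorField Filter Topology

set_option linter.unusedSectionVars false

noncomputable section

/-! ## Curvature of the Levi-Civita connection in coordinate fields -/

section Riemannian

variable {E : Type*} [NormedAddCommGroup E] [NormedSpace ℝ E] [FiniteDimensional ℝ E]
  {H : Type*} [TopologicalSpace H] {I : ModelWithCorners ℝ E H}
  {M : Type*} [TopologicalSpace M] [ChartedSpace H M] [IsManifold I ∞ M]

theorem two_le_infty : (2 : ℕ∞ω) ≤ ∞ := WithTop.coe_le_coe.2 (le_top : (2 : ℕ∞) ≤ ⊤)

/-- The vector field on `E` with constant value `u`. -/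
def constField (u : E) (z : E) : TangentSpace 𝓘(ℝ, E) z := u

/-- The standard extension of a tangent vector to a vector field; near the base point, it has
constant coefficients in the preferred chart. -/
abbrev coordField {x : M} (u : TangentSpace I x) : Π y : M, TangentSpace I y :=
  FiberBundle.extend E u

theorem coordField_eq_symm {x y : M} (u : TangentSpace I x) :
    coordField u y = (trivializationAt E (TangentSpace I : M → Type _) x).symm y (u : E) := by
  unfold coordField FiberBundle.extend
  have := TangentBundle.trivializationAt_apply (I := I) x ⟨x, u⟩
  congr 1
  have h2 := fderivWithin_extChartAt_comp_extChartAt_symm_range (I := I) (x := x)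
  rw [this]
  exact congrArg (fun L : E →L[ℝ] E ↦ L u) h2

theorem coordField_eq_symmL {x y : M} (hy : y ∈ (chartAt H x).source) (u : TangentSpace I x) :
    coordField u y =
      (trivializationAt E (TangentSpace I : M → Type _) x).symmL ℝ y (u : E) := by
  rw [coordField_eq_symm]
  exact (Trivialization.symmL_apply (R := ℝ)
    (trivializationAt E (TangentSpace I : M → Type _) x) hy (u : E)).symm

theorem mfderiv_extChartAt_coordField {x y : M} (hy : y ∈ (chartAt H x).source)
    (u : TangentSpace I x) :
    mfderiv I 𝓘(ℝ, E) (extChartAt I x) y (coordField u y) = constField (E := E) u _ := by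
  rw [← TangentBundle.continuousLinearMapAt_trivializationAt hy,
    coordField_eq_symmL hy]
  exact Trivialization.continuousLinearMapAt_symmL (R := ℝ)
    (trivializationAt E (TangentSpace I : M → Type _) x) hy (u : E)

theorem coordField_eq_mpullback {x y : M} (hy : y ∈ (chartAt H x).source) (u : TangentSpace I x) :
    coordField u y = mpullback I 𝓘(ℝ, E) (extChartAt I x) (constField (E := E) u) y := by
  rw [mpullback_apply, ← mfderiv_extChartAt_coordField hy]
  exact ((isInvertible_mfderiv_extChartAt (I := I) (by simpa using hy)).inverse_apply_eq.2 rfl).symm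

theorem eventually_mem_chartAt_source (x : M) : ∀ᶠ y in 𝓝 x, y ∈ (chartAt H x).source :=
  (chartAt H x).open_source.mem_nhds (mem_chart_source H x)

theorem mlieBracket_coordField {x y : M} (hy : y ∈ (chartAt H x).source) (u v : TangentSpace I x) :
    mlieBracket I (coordField u) (coordField v) y = 0 := by
  have : IsManifold I (minSmoothness ℝ 2) M := .of_le (n := ∞) (by
    rw [minSmoothness_of_isRCLikeNormedField]; exact two_le_infty)
  have hev : ∀ᶠ z in 𝓝 y, z ∈ (chartAt H x).source := (chartAt H x).open_source.mem_nhds hy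
  have h : ∀ w : TangentSpace I x, coordField w =ᶠ[𝓝 y]
      mpullback I 𝓘(ℝ, E) (extChartAt I x) (constField (E := E) w) :=
    fun w ↦ hev.mono fun z hz ↦ coordField_eq_mpullback hz w
  have hc : ∀ w : E, MDiffAt (T% (constField w)) (extChartAt I x y) := fun w ↦
    (contMDiffAt_vectorSpace_iff_contDiffAt.2
      (contDiffAt_const (c := w) (n := 1))).mdifferentiableAt one_ne_zero
  have hp : ∀ u v : E, mpullback I 𝓘(ℝ, E) (extChartAt I x) (mlieBracket 𝓘(ℝ, E)
      (constField u) (constField v)) y = mlieBracket I (mpullback I 𝓘(ℝ, E) (extChartAt I x)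
      (constField u)) (mpullback I 𝓘(ℝ, E) (extChartAt I x) (constField v)) y := fun u v ↦
    mpullback_mlieBracket (n := ∞) (hc u) (hc v) (contMDiffAt_extChartAt' hy) (by
      rw [minSmoothness_of_isRCLikeNormedField]; exact two_le_infty)
  rw [(h u).mlieBracket_vectorField_eq (h v)]
  refine (hp u v).symm.trans ?_
  have h0 : ∀ u v : E, mlieBracket 𝓘(ℝ, E) (constField u) (constField v) (extChartAt I x y) = 0 := by
    intro u v
    rw [← mlieBracketWithin_univ, mlieBracketWithin_eq_lieBracketWithin]
    have h0 : ∀ w : E, fderiv ℝ (fun _ : E ↦ w) (extChartAt I x y) = 0 := fun w ↦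
      fderiv_const_apply (𝕜 := ℝ) w
    have h1 : lieBracket ℝ (fun _ : E ↦ u) (fun _ : E ↦ v) (extChartAt I x y) = 0 := by
      rw [lieBracket, h0, h0]
      simp
    exact (congrFun (lieBracketWithin_univ (𝕜 := ℝ) (E := E) (V := fun _ ↦ u) (W := fun _ ↦ v)) _).trans h1
  rw [mpullback_apply]
  exact (congrArg (mfderiv I 𝓘(ℝ, E) (extChartAt I x) y).inverse (h0 u v)).trans
    (map_zero (mfderiv I 𝓘(ℝ, E) (extChartAt I x) y).inverse)

theorem contMDiffAt_mvfderiv_coordField {x : M} {h : M → ℝ} (hh : ContMDiffAt I 𝓘(ℝ, ℝ) ∞ h x)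
    (u : TangentSpace I x) :
    ContMDiffAt I 𝓘(ℝ, ℝ) ∞ (fun y ↦ mvfderiv I h y (coordField u y)) x := by
  have h1 := hh.mfderiv_const (m := ∞) (by simp)
  have h2 : ContMDiffAt I 𝓘(ℝ, ℝ) ∞ 
    (fun y ↦ inTangentCoordinates I 𝓘(ℝ, ℝ) id h (mfderiv I 𝓘(ℝ, ℝ) h) x y (u : E)) x := 
    h1.clm_apply contMDiffAt_const
  refine h2.congr_of_eventuallyEq ?_
  filter_upwards [eventually_mem_chartAt_source (H := H) x] with y hy
  have := inTangentCoordinates_eq (I := I) (I' := 𝓘(ℝ, ℝ)) id h (mfderiv I 𝓘(ℝ, ℝ) h)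
    (x₀ := x) (x := y) hy (Set.mem_univ _)
  rw [coordField_eq_symmL hy,
    TangentBundle.symmL_trivializationAt_eq_core hy]
  refine Eq.trans ?_ (congrArg (fun L : E →L[ℝ] ℝ ↦ L u) this).symm
  simp
  rfl

theorem coordField_add {x y : M} (hy : y ∈ (chartAt H x).source) (u v : TangentSpace I x) :
    coordField (u + v) y = coordField u y + coordField v y := by
  simp only [coordField_eq_symmL hy]
  exact map_add ((trivializationAt E (TangentSpace I : M → Type _) x).symmL ℝ y) (u : E) v

theorem coordField_smul {x y : M} (hy : y ∈ (chartAt H x).source) (c : ℝ)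
    (u : TangentSpace I x) : coordField (c • u) y = c • coordField u y := by
  simp only [coordField_eq_symmL hy]
  exact map_smul ((trivializationAt E (TangentSpace I : M → Type _) x).symmL ℝ y) c (u : E)

theorem contMDiffAt_coordField {x : M} (u : TangentSpace I x) : CMDiffAt ∞ (T% (coordField u)) x :=
  FiberBundle.contMDiffAt_extend ..

theorem mdiffAt_coordField {x : M} (u : TangentSpace I x) : MDiffAt (T% (coordField u)) x :=
  FiberBundle.mdifferentiableAt_extend ..

theorem eventually_mdiffAt_coordField {x : M} (u : TangentSpace I x) :
    ∀ᶠ y in 𝓝 x, MDiffAt (T% (coordField u)) y :=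
  ((contMDiffAt_iff_contMDiffAt_nhds (by simp)).1 ((contMDiffAt_coordField u).of_le
    (show (1 : ℕ∞ω) ≤ ∞ from mod_cast le_top))).mono fun _ h ↦ h.mdifferentiableAt one_ne_zero

theorem contMDiffAt_inner (g : SmoothMetric I M) {X Y : Π x : M, TangentSpace I x} {x : M}
    (hX : CMDiffAt ∞ (T% X) x) (hY : CMDiffAt ∞ (T% Y) x) :
    ContMDiffAt I 𝓘(ℝ, ℝ) ∞ (fun y ↦ g.inner y (X y) (Y y)) x := by
  have : ContMDiffAt I (I.prod 𝓘(ℝ)) ∞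
      (fun m ↦ TotalSpace.mk' ℝ (E := Bundle.Trivial M ℝ) m (g.inner m (X m) (Y m))) x := by
    apply ContMDiffAt.clm_bundle_apply₂ (F₁ := E) (F₂ := E)
    · exact g.contMDiff.contMDiffAt
    · exact hX
    · exact hY
  rw [contMDiffAt_totalSpace] at this
  exact this.2

/-- The coefficient functions of the metric in coordinate fields. -/
def metricCoeff (g : SmoothMetric I M) {x : M} (u v : TangentSpace I x) (y : M) : ℝ :=
  g.inner y (coordField u y) (coordField v y)

/-- The coefficient functions `g(∇_u v, w)` of the Levi-Civita connection in coordinate fields. -/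
def christoffel (g : SmoothMetric I M) {x : M} (u v w : TangentSpace I x) (y : M) : ℝ :=
  g.inner y (leviCivita g (coordField v) y (coordField u y)) (coordField w y)

theorem christoffel_self (g : SmoothMetric I M) {x : M} (u v w : TangentSpace I x) :
    christoffel g u v w x = g.inner x (leviCivita g (coordField v) x u) w := by
  simp [christoffel]

theorem two_mul_christoffel_eventuallyEq (g : SmoothMetric I M) {x : M} (u v w : TangentSpace I x) :
    (fun y ↦ 2 * christoffel g u v w y) =ᶠ[𝓝 x] fun y ↦
      mvfderiv I (metricCoeff g v w) y (coordField u y)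
        + mvfderiv I (metricCoeff g w u) y (coordField v y)
        - mvfderiv I (metricCoeff g u v) y (coordField w y) := by
  filter_upwards [eventually_mem_chartAt_source (H := H) x, eventually_mdiffAt_coordField u,
    eventually_mdiffAt_coordField v, eventually_mdiffAt_coordField w] with y hy hu hv hw
  rw [christoffel, inner_leviCivita g hu hv hw, koszul, mlieBracket_coordField hy,
    mlieBracket_coordField hy, mlieBracket_coordField hy]
  simp only [map_zero, zero_apply, add_zero, sub_zero]
  rfl

theorem contMDiffAt_christoffel (g : SmoothMetric I M) {x : M} (u v w : TangentSpace I x) :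
    ContMDiffAt I 𝓘(ℝ, ℝ) ∞ (christoffel g u v w) x := by
  have h : ∀ a b c : TangentSpace I x, ContMDiffAt I 𝓘(ℝ, ℝ) ∞ (fun y ↦
      mvfderiv I (metricCoeff g a b) y (coordField c y)) x :=
    fun a b c ↦ contMDiffAt_mvfderiv_coordField
      (contMDiffAt_inner g (contMDiffAt_coordField a) (contMDiffAt_coordField b)) c
  have h2 := (((h v w u).add (h w u v)).sub (h u v w)).congr_of_eventuallyEq
    (two_mul_christoffel_eventuallyEq g u v w)
  have h3 := (contMDiffAt_const (c := (1 / 2 : ℝ))).mul h2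
  refine h3.congr_of_eventuallyEq (.of_forall fun y ↦ ?_)
  simp

theorem mdiffAt_of_inner (g : SmoothMetric I M) {σ : Π x : M, TangentSpace I x} {x : M}
    (h : ∀ w : TangentSpace I x, MDifferentiableAt I 𝓘(ℝ, ℝ)
      (fun y ↦ g.inner y (σ y) (coordField w y)) x) :
    MDiffAt (T% σ) x := by
  set e := trivializationAt E (TangentSpace I : M → Type _) x with he
  have hxe : x ∈ e.baseSet := FiberBundle.mem_baseSet_trivializationAt' x
  have hnhds : ∀ᶠ y in 𝓝 x, y ∈ e.baseSet := e.open_baseSet.mem_nhds hxe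
  obtain ⟨G, hG, hGa⟩ : ∃ G : M → E →L[ℝ] E →L[ℝ] ℝ, ContMDiffAt I 𝓘(ℝ, E →L[ℝ] E →L[ℝ] ℝ) ∞ G x ∧
      ∀ y ∈ e.baseSet, ∀ v w : E, G y v w = g.inner y (e.symm y v) (e.symm y w) := by
    have := g.contMDiff.contMDiffAt (x := x)
    rw [contMDiffAt_hom_bundle] at this
    refine ⟨_, this.2, fun y hy v w ↦ ?_⟩
    rw [inCoordinates_apply_eq₂ hy hy (Set.mem_univ _)]
    simp [he]
  have hinv : ∀ y ∈ e.baseSet, (G y).IsInvertible := by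
    intro y hy
    have hinj : Function.Injective (G y : E →ₗ[ℝ] E →L[ℝ] ℝ) := by
      rw [injective_iff_map_eq_zero]
      intro v hv
      by_contra hne
      have h1 := hGa y hy v v
      have h2 : e.symm y v ≠ 0 := by
        intro h0
        apply hne
        rw [← e.continuousLinearMapAt_symmL (R := ℝ) hy v, e.symmL_apply (R := ℝ) hy, h0, map_zero]
      have h3 : G y v = 0 := hv
      rw [h3] at h1
      exact (g.pos y _ h2).ne h1
    have hfr : Module.finrank ℝ E = Module.finrank ℝ (E →L[ℝ] ℝ) := by
      rw [← (LinearMap.toContinuousLinearMap (𝕜 := ℝ) (E := E) (F' := ℝ)).finrank_eq]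
      exact Subspace.dual_finrank_eq.symm
    exact ⟨(LinearEquiv.ofInjectiveOfFinrankEq _ hinj hfr).toContinuousLinearEquiv, by ext; rfl⟩
  let L : M → E →L[ℝ] ℝ := fun y ↦ (g.inner y (σ y)).comp (e.symmL ℝ y)
  have hc : ∀ w : E,
      MDifferentiableAt I 𝓘(ℝ, ℝ) (fun y ↦ g.inner y (σ y) (e.symmL ℝ y w)) x := fun w ↦
    (h w).congr_of_eventuallyEq (hnhds.mono fun y hy ↦
      congrArg (g.inner y (σ y)) (coordField_eq_symmL (x := x) hy (u := w)).symm)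
  have hL : MDifferentiableAt I 𝓘(ℝ, E →L[ℝ] ℝ) L x := by
    let b := Module.finBasis ℝ E
    have h1 : MDifferentiableAt I 𝓘(ℝ, E →L[ℝ] ℝ) (fun y ↦ ∑ i,
        g.inner y (σ y) (e.symmL ℝ y (b i)) • LinearMap.toContinuousLinearMap (b.coord i)) x := by
      simp only [← Finset.sum_fn]
      exact MDifferentiableAt.sum fun i _ ↦ (hc (b i)).smul mdifferentiableAt_const
    refine h1.congr_of_eventuallyEq ?_
    filter_upwards [hnhds] with y hy
    ext w
    conv_lhs => rw [← b.sum_repr w]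
    simp only [L, map_sum, map_smul]
    simp only [ContinuousLinearMap.comp_apply, sum_apply, smul_apply,
      LinearMap.coe_toContinuousLinearMap', Module.Basis.coord_apply, smul_eq_mul]
    refine Finset.sum_congr rfl fun i _ ↦ ?_
    rw [mul_comm]
  have hs : (fun y ↦ (e ⟨y, σ y⟩).2) =ᶠ[𝓝 x] fun y ↦ (G y).inverse (L y) := by
    filter_upwards [hnhds] with y hy
    symm
    rw [(hinv y hy).inverse_apply_eq]
    ext w
    rw [hGa y hy, e.symm_apply_apply_mk hy]
    simp only [L, ContinuousLinearMap.comp_apply, e.symmL_apply (R := ℝ) hy]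
  rw [e.mdifferentiableAt_section_iff I σ hxe]
  refine MDifferentiableAt.congr_of_eventuallyEq ?_ hs
  have h3 : MDifferentiableAt I 𝓘(ℝ, (E →L[ℝ] ℝ) →L[ℝ] E) (fun y ↦ (G y).inverse) x :=
    (((hinv x hxe).contDiffAt_map_inverse (n := 1)).differentiableAt one_ne_zero).comp_mdifferentiableAt
      (hG.mdifferentiableAt (by simp))
  exact h3.clm_apply hL

theorem mdiffAt_leviCivita_coordField (g : SmoothMetric I M) {x : M} (u v : TangentSpace I x) :
    MDiffAt (T% (fun y ↦ leviCivita g (coordField v) y (coordField u y))) x :=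
  mdiffAt_of_inner g fun w ↦ (contMDiffAt_christoffel g u v w).mdifferentiableAt (by simp)

theorem mvfderiv_congr {h h' : M → ℝ} {x : M} (hh : h =ᶠ[𝓝 x] h') :
    mvfderiv I h x = mvfderiv I h' x := by
  ext v
  exact congrArg (fun L : TangentSpace I x →L[ℝ] ℝ ↦ L v) hh.mfderiv_eq

theorem mdiffAt_christoffel (g : SmoothMetric I M) {x : M} (u v w : TangentSpace I x) :
    MDifferentiableAt I 𝓘(ℝ, ℝ) (christoffel g u v w) x :=
  (contMDiffAt_christoffel g u v w).mdifferentiableAt (by simp)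

theorem mvfderiv_christoffel (g : SmoothMetric I M) {x : M} (u v w z : TangentSpace I x) :
    mvfderiv I (christoffel g u v w) x z
      = g.inner x (leviCivita g (fun y ↦ leviCivita g (coordField v) y (coordField u y)) x z) w
        + g.inner x (leviCivita g (coordField v) x u) (leviCivita g (coordField w) x z) := by
  have := leviCivita_metric g (mdiffAt_coordField z) (mdiffAt_leviCivita_coordField g u v)
    (mdiffAt_coordField w)
  simp only [FiberBundle.extend_apply_self] at this
  exact this

/-- The `(0,4)`-curvature tensor of the Levi-Civita connection in terms of the functions
`g(∇_u v, w)`. -/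
def curvatureForm (g : SmoothMetric I M) {x : M} (u v w z : TangentSpace I x) : ℝ :=
  mvfderiv I (christoffel g v w z) x u
    - g.inner x (leviCivita g (coordField w) x v) (leviCivita g (coordField z) x u)
    - (mvfderiv I (christoffel g u w z) x v
      - g.inner x (leviCivita g (coordField w) x u) (leviCivita g (coordField z) x v))

theorem inner_curvature_leviCivita (g : SmoothMetric I M) {x : M} (u v w z : TangentSpace I x) :
    g.inner x (curvature (leviCivita g) (coordField u) (coordField v) (coordField w) x) z
      = curvatureForm g u v w z := by
  rw [curvatureForm, mvfderiv_christoffel, mvfderiv_christoffel, curvature,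
    mlieBracket_coordField (mem_chart_source H x)]
  simp

theorem christoffel_add_eventuallyEq (g : SmoothMetric I M) {x : M} (u u' v w : TangentSpace I x) :
    christoffel g (u + u') v w =ᶠ[𝓝 x] christoffel g u v w + christoffel g u' v w := by
  filter_upwards [eventually_mem_chartAt_source (H := H) x] with y hy
  simp [christoffel, coordField_add hy]

theorem christoffel_smul_eventuallyEq (g : SmoothMetric I M) {x : M} (c : ℝ)
    (u v w : TangentSpace I x) :
    christoffel g (c • u) v w =ᶠ[𝓝 x] (fun _ ↦ c) * christoffel g u v w := by
  filter_upwards [eventually_mem_chartAt_source (H := H) x] with y hy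
  simp [christoffel, coordField_smul hy]

/-- For fixed `u` and `w`, the curvature form `R(u,v,w,z)` as a bilinear form in `v` and `z`. -/
def curvatureBilin (g : SmoothMetric I M) {x : M} (u w : TangentSpace I x) :
    TangentSpace I x →ₗ[ℝ] TangentSpace I x →ₗ[ℝ] ℝ :=
  LinearMap.mk₂ ℝ (fun v z ↦ curvatureForm g u v w z)
    (fun v v' z ↦ by
      simp only [curvatureForm, mvfderiv_congr (christoffel_add_eventuallyEq g v v' w z),
        mvfderiv_add (mdiffAt_christoffel g v w z) (mdiffAt_christoffel g v' w z), map_add,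
        add_apply]
      ring)
    (fun c v z ↦ by
      simp only [curvatureForm, mvfderiv_congr (christoffel_smul_eventuallyEq g c v w z),
        mvfderiv_mul mdifferentiableAt_const (mdiffAt_christoffel g v w z), map_smul,
        smul_apply, add_apply, mvfderiv_const, smul_eq_mul]
      simp
      ring)
    (fun v z z' ↦ by simp only [← inner_curvature_leviCivita, map_add])
    (fun c v z ↦ by simp only [← inner_curvature_leviCivita, map_smul])

/-- The trace of a bilinear form over the chosen orthonormal basis is its trace over any
orthonormal frame. -/
theorem sum_onb_eq (g : SmoothMetric I M) {x : M}
    (T : TangentSpace I x →ₗ[ℝ] TangentSpace I x →ₗ[ℝ] ℝ) {ι : Type*} [Fintype ι]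
    (a : ι → TangentSpace I x) (ha : ∀ v, ∑ i, g.inner x v (a i) • a i = v) :
    ∑ k, T (onb g x k) (onb g x k) = ∑ i, T (a i) (a i) := by
  calc ∑ k, T (onb g x k) (onb g x k)
      = ∑ k, ∑ i, g.inner x (onb g x k) (a i) * T (a i) (onb g x k) := by
        refine Finset.sum_congr rfl fun k _ ↦ ?_
        conv_lhs => enter [1]; rw [← ha (onb g x k)]
        simp
    _ = ∑ i, T (a i) (∑ k, g.inner x (a i) (onb g x k) • onb g x k) := by
        rw [Finset.sum_comm]
        refine Finset.sum_congr rfl fun i _ ↦ ?_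
        rw [map_sum]
        refine Finset.sum_congr rfl fun k _ ↦ ?_
        rw [map_smul, g.symm x (a i), smul_eq_mul]
    _ = ∑ i, T (a i) (a i) := by simp only [onb_sum]

theorem ricci_leviCivita (g : SmoothMetric I M) (x : M) (u v : TangentSpace I x) {ι : Type*}
    [Fintype ι] (a : ι → TangentSpace I x) (ha : ∀ v, ∑ i, g.inner x v (a i) • a i = v) :
    ricci g (leviCivita g) x u v = ∑ i, curvatureForm g u (a i) v (a i) := by
  refine Eq.trans ?_ (sum_onb_eq g (curvatureBilin g u v) a ha)
  exact Finset.sum_congr rfl fun k _ ↦ inner_curvature_leviCivita g u _ v _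

/-- The tensor `(∇_u π)(v) - π(u) π(v)` by which the curvatures of the semi-symmetric and of the
Levi-Civita connection differ. -/
def semiSymmetricTensor (g : SmoothMetric I M) (P : Π x : M, TangentSpace I x) {x : M}
    (u v : TangentSpace I x) : ℝ :=
  g.inner x v (leviCivita g P x u) - g.inner x u (P x) * g.inner x v (P x)

theorem semiSymmetricConnection_coordField (g : SmoothMetric I M)
    {P : Π x : M, TangentSpace I x} {x : M} (hP : MDiffAt (T% P) x) (u v w : TangentSpace I x) :
    semiSymmetricConnection g P
        (fun y ↦ semiSymmetricConnection g P (coordField w) y (coordField v y)) x u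
      = leviCivita g (fun y ↦ leviCivita g (coordField w) y (coordField v y)) x u
        + g.inner x w (P x) • leviCivita g (coordField v) x u
        + (g.inner x (leviCivita g (coordField w) x u) (P x)
          + g.inner x w (leviCivita g P x u)) • v
        + (g.inner x (leviCivita g (coordField w) x v) (P x)
          + g.inner x w (P x) * g.inner x v (P x)) • u := by
  have h0 : (fun y ↦ semiSymmetricConnection g P (coordField w) y (coordField v y))
      = (fun y ↦ leviCivita g (coordField w) y (coordField v y))
        + (fun y ↦ g.inner y (coordField w y) (P y)) • coordField v := by
    ext1 y
    rw [semiSymmetricConnection_apply]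
    rfl
  have hφ := mdiff_inner g (mdiffAt_coordField w) hP
  have h1 := leviCivita_metric g (mdiffAt_coordField u) (mdiffAt_coordField w) hP
  simp only [FiberBundle.extend_apply_self] at h1
  rw [semiSymmetricConnection_apply, h0,
    (leviCivita g).isCovariantDerivativeOnUniv.add (mdiffAt_leviCivita_coordField g v w)
      (hφ.smul_section (mdiffAt_coordField v)),
    (leviCivita g).isCovariantDerivativeOnUniv.leibniz (mdiffAt_coordField v) hφ]
  simp [h1, semiSymmetricConnection_apply]
  module

theorem curvature_semiSymmetricConnection (g : SmoothMetric I M)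
    {P : Π x : M, TangentSpace I x} {x : M} (hP : MDiffAt (T% P) x) (u v w : TangentSpace I x) :
    curvature (semiSymmetricConnection g P) (coordField u) (coordField v) (coordField w) x
      = curvature (leviCivita g) (coordField u) (coordField v) (coordField w) x
        + semiSymmetricTensor g P u w • v - semiSymmetricTensor g P v w • u := by
  have ht := leviCivita_torsion g (mdiffAt_coordField u) (mdiffAt_coordField v)
  rw [mlieBracket_coordField (mem_chart_source H x)] at ht
  simp only [FiberBundle.extend_apply_self] at ht
  have ht' := sub_eq_zero.1 ht
  rw [curvature, curvature, mlieBracket_coordField (mem_chart_source H x)]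
  simp only [FiberBundle.extend_apply_self, map_zero, semiSymmetricConnection_coordField g hP, ht',
    semiSymmetricTensor]
  module

theorem ricci_semiSymmetricConnection (g : SmoothMetric I M)
    {P : Π x : M, TangentSpace I x} {x : M} (hP : MDiffAt (T% P) x) (u v : TangentSpace I x) :
    ricci g (semiSymmetricConnection g P) x u v
      = ricci g (leviCivita g) x u v
        + (Module.finrank ℝ E - 1) * semiSymmetricTensor g P u v := by
  have h1 : ∑ k, semiSymmetricTensor g P (onb g x k) v * g.inner x u (onb g x k)
      = semiSymmetricTensor g P u v := by
    conv_rhs => rw [← onb_sum g x u]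
    simp only [semiSymmetricTensor, map_sum, map_smul, sum_apply, smul_apply, smul_eq_mul,
      Finset.sum_mul, ← Finset.sum_sub_distrib]
    exact Finset.sum_congr rfl fun k _ ↦ by ring
  have h2 : ∀ k, g.inner x (curvature (semiSymmetricConnection g P) (coordField u)
      (coordField (onb g x k)) (coordField v) x) (onb g x k)
    = g.inner x (curvature (leviCivita g) (coordField u)
      (coordField (onb g x k)) (coordField v) x) (onb g x k) + semiSymmetricTensor g P u v
      - semiSymmetricTensor g P (onb g x k) v * g.inner x u (onb g x k) := by
    intro k
    rw [curvature_semiSymmetricConnection g hP]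
    simp [onb_inner]
  unfold ricci
  rw [Finset.sum_congr rfl fun k _ ↦ h2 k, Finset.sum_sub_distrib, Finset.sum_add_distrib, h1]
  simp
  ring

theorem semiSymmetricTensor_zero (g : SmoothMetric I M) {x : M} (u v : TangentSpace I x) :
    semiSymmetricTensor g 0 u v = 0 := by
  simp [semiSymmetricTensor]

theorem hessian_eq (g : SmoothMetric I M) {f : M → ℝ} {x : M} (u v : TangentSpace I x) :
    mvfderiv I (fun y ↦ mvfderiv I f y (coordField v y)) x u
      = hessian g f x u v + mvfderiv I f x (leviCivita g (coordField v) x u) := by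
  rw [hessian]; ring

theorem coordField_eq_tangentCoordChange {x y : M} (hy : y ∈ (chartAt H x).source)
    (u : TangentSpace I x) : coordField u y = tangentCoordChange I x y y u := by
  rw [coordField_eq_symmL hy, TangentBundle.symmL_trivializationAt_eq_core hy]
  rfl

theorem coordField_zero {x y : M} (hy : y ∈ (chartAt H x).source) :
    coordField (0 : TangentSpace I x) y = 0 := by
  rw [coordField_eq_symmL hy]
  exact map_zero ((trivializationAt E (TangentSpace I : M → Type _) x).symmL ℝ y)

theorem metricCoeff_self (g : SmoothMetric I M) {x : M} (u v : TangentSpace I x) :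
    metricCoeff g u v x = g.inner x u v := by
  simp [metricCoeff]

theorem metricCoeff_symm (g : SmoothMetric I M) {x : M} (u v : TangentSpace I x) :
    metricCoeff g u v = metricCoeff g v u :=
  funext fun _ ↦ g.symm _ _ _

theorem metricCoeff_zero_left (g : SmoothMetric I M) {x y : M} (hy : y ∈ (chartAt H x).source)
    (v : TangentSpace I x) : metricCoeff g 0 v y = 0 := by
  simp [metricCoeff, coordField_zero hy]

theorem metricCoeff_zero_right (g : SmoothMetric I M) {x y : M} (hy : y ∈ (chartAt H x).source)
    (v : TangentSpace I x) : metricCoeff g v 0 y = 0 := by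
  simp [metricCoeff, coordField_zero hy]

theorem christoffel_zero_left (g : SmoothMetric I M) {x y : M} (hy : y ∈ (chartAt H x).source)
    (v w : TangentSpace I x) : christoffel g 0 v w y = 0 := by
  simp [christoffel, coordField_zero hy]

theorem leviCivita_coordField_zero (g : SmoothMetric I M) {x y : M}
    (hy : y ∈ (chartAt H x).source) : leviCivita g (coordField (0 : TangentSpace I x)) y = 0 := by
  have hev : coordField (0 : TangentSpace I x) =ᶠ[𝓝 y] (0 : Π z : M, TangentSpace I z) := by
    filter_upwards [(chartAt H x).open_source.mem_nhds hy] with z hz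
    exact coordField_zero hz
  have h0 : MDiffAt (T% (0 : Π z : M, TangentSpace I z)) y := mdifferentiableAt_zeroSection ..
  refine ((leviCivita g).isCovariantDerivativeOnUniv.congr_of_eventuallyEq ?_ h0 ?_ hev).trans ?_
  · refine h0.congr_of_eventuallyEq (hev.mono fun z hz ↦ ?_)
    exact congrArg (TotalSpace.mk' E z) hz
  · exact univ_mem
  · simp

theorem christoffel_zero_mid (g : SmoothMetric I M) {x y : M} (hy : y ∈ (chartAt H x).source)
    (v w : TangentSpace I x) : christoffel g v 0 w y = 0 := by
  simp [christoffel, leviCivita_coordField_zero g hy]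

theorem christoffel_zero_right (g : SmoothMetric I M) {x y : M} (hy : y ∈ (chartAt H x).source)
    (v w : TangentSpace I x) : christoffel g v w 0 y = 0 := by
  simp [christoffel, coordField_zero hy]

theorem contMDiffAt_metricCoeff (g : SmoothMetric I M) {x : M} (u v : TangentSpace I x) :
    ContMDiffAt I 𝓘(ℝ, ℝ) ∞ (metricCoeff g u v) x :=
  contMDiffAt_inner g (contMDiffAt_coordField u) (contMDiffAt_coordField v)

theorem mdiffAt_metricCoeff (g : SmoothMetric I M) {x : M} (u v : TangentSpace I x) :
    MDifferentiableAt I 𝓘(ℝ, ℝ) (metricCoeff g u v) x :=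
  (contMDiffAt_metricCoeff g u v).mdifferentiableAt (by simp)

theorem eventually_mdiffAt_metricCoeff (g : SmoothMetric I M) {x : M} (u v : TangentSpace I x) :
    ∀ᶠ y in 𝓝 x, MDifferentiableAt I 𝓘(ℝ, ℝ) (metricCoeff g u v) y := by
  filter_upwards [eventually_mdiffAt_coordField u, eventually_mdiffAt_coordField v] with y hu hv
  exact mdiff_inner g hu hv

theorem inner_left_ext (g : SmoothMetric I M) {x : M} {a b : TangentSpace I x}
    (h : ∀ w, g.inner x a w = g.inner x b w) : a = b := by
  by_contra hne
  have := g.pos x (a - b) (sub_ne_zero.2 hne)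
  have h2 := h (a - b)
  rw [← sub_eq_zero, ← sub_apply, ← map_sub] at h2
  exact this.ne' h2

end Riemannian

/-! ## Curvature of warped products -/

section Warped

variable {EB : Type*} [NormedAddCommGroup EB] [NormedSpace ℝ EB] [FiniteDimensional ℝ EB]
  {HB : Type*} [TopologicalSpace HB] {IB : ModelWithCorners ℝ EB HB}
  {B : Type*} [TopologicalSpace B] [ChartedSpace HB B] [IsManifold IB ∞ B]
  {EF : Type*} [NormedAddCommGroup EF] [NormedSpace ℝ EF] [FiniteDimensional ℝ EF]
  {HF : Type*} [TopologicalSpace HF] {IF : ModelWithCorners ℝ EF HF}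
  {F : Type*} [TopologicalSpace F] [ChartedSpace HF F] [IsManifold IF ∞ F]

theorem coordField_prod {x y : B × F} (hB : y.1 ∈ (chartAt HB x.1).source)
    (hF : y.2 ∈ (chartAt HF x.2).source) (w : TangentSpace (IB.prod IF) x) :
    coordField w y = (coordField (basePart IB IF x w) y.1, coordField (fibrePart IB IF x w) y.2) := by
  have hy : y ∈ (chartAt (ModelProd HB HF) x).source := ⟨hB, hF⟩
  rw [coordField_eq_tangentCoordChange hB, coordField_eq_tangentCoordChange hF,
    coordField_eq_tangentCoordChange hy]
  have h1 := hasFDerivWithinAt_tangentCoordChange (I := IB) (x := x.1) (y := y.1) (z := y.1)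
    ⟨by simpa using hB, by simp⟩
  have h2 := hasFDerivWithinAt_tangentCoordChange (I := IF) (x := x.2) (y := y.2) (z := y.2)
    ⟨by simpa using hF, by simp⟩
  have h3 := hasFDerivWithinAt_tangentCoordChange (I := IB.prod IF) (x := x) (y := y) (z := y)
    ⟨by simpa using ⟨hB, hF⟩, by simp⟩
  have h4 : HasFDerivWithinAt (Prod.map ((extChartAt IB y.1) ∘ (extChartAt IB x.1).symm)
      ((extChartAt IF y.2) ∘ (extChartAt IF x.2).symm))
      ((tangentCoordChange IB x.1 y.1 y.1).prodMap (tangentCoordChange IF x.2 y.2 y.2))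
      (Set.range (IB.prod IF)) (extChartAt (IB.prod IF) x y) := by
    rw [ModelWithCorners.range_prod]
    exact HasFDerivWithinAt.prodMap (extChartAt IB x.1 y.1, extChartAt IF x.2 y.2)
      (h1.mono (by rintro _ ⟨p, hp, rfl⟩; exact hp.1)) (h2.mono (by rintro _ ⟨p, hp, rfl⟩; exact hp.2))
  have h5 : ((extChartAt (IB.prod IF) y) ∘ (extChartAt (IB.prod IF) x).symm)
    = Prod.map ((extChartAt IB y.1) ∘ (extChartAt IB x.1).symm)
      ((extChartAt IF y.2) ∘ (extChartAt IF x.2).symm) := by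
    rw [extChartAt_prod, extChartAt_prod]; rfl
  rw [h5] at h3
  have hu := (IB.prod IF).uniqueDiffOn (extChartAt (IB.prod IF) x y) ⟨chartAt _ x y, rfl⟩
  have := hu.eq h3 h4
  rw [this]
  rfl

theorem eventually_coordField_prod (x : B × F) : ∀ᶠ y in 𝓝 x, ∀ w : TangentSpace (IB.prod IF) x,
    basePart IB IF y (coordField w y) = coordField (basePart IB IF x w) y.1 ∧
      fibrePart IB IF y (coordField w y) = coordField (fibrePart IB IF x w) y.2 := by
  filter_upwards [continuousAt_fst.eventually (eventually_mem_chartAt_source (H := HB) x.1),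
    continuousAt_snd.eventually (eventually_mem_chartAt_source (H := HF) x.2)] with y hB hF w
  have := coordField_prod hB hF w
  exact ⟨congrArg Prod.fst this, congrArg Prod.snd this⟩

theorem mdiffAt_comp_fst {h : B → ℝ} {x : B × F} (hh : MDifferentiableAt IB 𝓘(ℝ, ℝ) h x.1) :
    MDifferentiableAt (IB.prod IF) 𝓘(ℝ, ℝ) (fun y : B × F ↦ h y.1) x :=
  MDifferentiableAt.comp x hh mdifferentiableAt_fst

theorem mdiffAt_comp_snd {h : F → ℝ} {x : B × F} (hh : MDifferentiableAt IF 𝓘(ℝ, ℝ) h x.2) :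
    MDifferentiableAt (IB.prod IF) 𝓘(ℝ, ℝ) (fun y : B × F ↦ h y.2) x :=
  MDifferentiableAt.comp x hh mdifferentiableAt_snd

theorem mvfderiv_comp_fst {h : B → ℝ} {x : B × F} (hh : MDifferentiableAt IB 𝓘(ℝ, ℝ) h x.1)
    (w : TangentSpace (IB.prod IF) x) :
    mvfderiv (IB.prod IF) (fun y : B × F ↦ h y.1) x w = mvfderiv IB h x.1 (basePart IB IF x w) := by
  rw [basePart_eq]
  exact mvfderiv_comp_apply x hh mdifferentiableAt_fst w

theorem mvfderiv_comp_snd {h : F → ℝ} {x : B × F} (hh : MDifferentiableAt IF 𝓘(ℝ, ℝ) h x.2)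
    (w : TangentSpace (IB.prod IF) x) :
    mvfderiv (IB.prod IF) (fun y : B × F ↦ h y.2) x w = mvfderiv IF h x.2 (fibrePart IB IF x w) := by
  rw [fibrePart_eq]
  exact mvfderiv_comp_apply x hh mdifferentiableAt_snd w

@[simp] theorem basePart_horizontal (x : B × F) (u : TangentSpace IB x.1) :
    basePart IB IF x (horizontal IB IF x u) = u := rfl

@[simp] theorem fibrePart_horizontal (x : B × F) (u : TangentSpace IB x.1) :
    fibrePart IB IF x (horizontal IB IF x u) = 0 := rfl

@[simp] theorem basePart_vertical (x : B × F) (u : TangentSpace IF x.2) :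
    basePart IB IF x (vertical IB IF x u) = 0 := rfl

@[simp] theorem fibrePart_vertical (x : B × F) (u : TangentSpace IF x.2) :
    fibrePart IB IF x (vertical IB IF x u) = u := rfl

theorem mvfderiv_fst_add_mul {a b : B → ℝ} {c : F → ℝ} {x : B × F}
    (ha : MDifferentiableAt IB 𝓘(ℝ, ℝ) a x.1) (hb : MDifferentiableAt IB 𝓘(ℝ, ℝ) b x.1)
    (hc : MDifferentiableAt IF 𝓘(ℝ, ℝ) c x.2) (w : TangentSpace (IB.prod IF) x) :
    mvfderiv (IB.prod IF) (fun y : B × F ↦ a y.1 + b y.1 * c y.2) x w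
      = mvfderiv IB a x.1 (basePart IB IF x w)
        + (b x.1 * mvfderiv IF c x.2 (fibrePart IB IF x w)
          + c x.2 * mvfderiv IB b x.1 (basePart IB IF x w)) := by
  have hb' := mdiffAt_comp_fst (IF := IF) hb
  have hc' := mdiffAt_comp_snd (IB := IB) hc
  have hbc : MDifferentiableAt (IB.prod IF) 𝓘(ℝ, ℝ) (fun y : B × F ↦ b y.1 * c y.2) x := hb'.mul hc'
  rw [mvfderiv_fun_add (mdiffAt_comp_fst (IF := IF) ha) hbc, mvfderiv_fun_mul hb' hc']
  simp only [add_apply, smul_apply, smul_eq_mul, mvfderiv_comp_fst ha, mvfderiv_comp_fst hb,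
    mvfderiv_comp_snd hc]

theorem mvfderiv_fst_mul {b : B → ℝ} {c : F → ℝ} {x : B × F}
    (hb : MDifferentiableAt IB 𝓘(ℝ, ℝ) b x.1) (hc : MDifferentiableAt IF 𝓘(ℝ, ℝ) c x.2)
    (w : TangentSpace (IB.prod IF) x) :
    mvfderiv (IB.prod IF) (fun y : B × F ↦ b y.1 * c y.2) x w
      = b x.1 * mvfderiv IF c x.2 (fibrePart IB IF x w)
        + c x.2 * mvfderiv IB b x.1 (basePart IB IF x w) := by
  have hb' := mdiffAt_comp_fst (IF := IF) hb
  have hc' := mdiffAt_comp_snd (IB := IB) hc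
  rw [mvfderiv_fun_mul hb' hc']
  simp only [add_apply, smul_apply, smul_eq_mul, mvfderiv_comp_fst hb, mvfderiv_comp_snd hc]

variable (gB : SmoothMetric IB B) (gF : SmoothMetric IF F) {f : B → ℝ}
  (hf : ContMDiff IB 𝓘(ℝ) ∞ f) (hpos : ∀ p, 0 < f p)

theorem warpedMetric_inner (x : B × F) (u v : TangentSpace (IB.prod IF) x) :
    (warpedMetric gB gF f hf hpos).inner x u v
      = gB.inner x.1 (basePart IB IF x u) (basePart IB IF x v)
      + f x.1 ^ 2 * gF.inner x.2 (fibrePart IB IF x u) (fibrePart IB IF x v) := rfl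

theorem metricCoeff_warped (x : B × F) (u v : TangentSpace (IB.prod IF) x) :
    metricCoeff (warpedMetric gB gF f hf hpos) u v =ᶠ[𝓝 x] fun y ↦
      metricCoeff gB (basePart IB IF x u) (basePart IB IF x v) y.1
        + f y.1 * f y.1 * metricCoeff gF (fibrePart IB IF x u) (fibrePart IB IF x v) y.2 := by
  filter_upwards [eventually_coordField_prod (IB := IB) (IF := IF) x] with y hy
  rw [metricCoeff, warpedMetric_inner, (hy u).1, (hy u).2, (hy v).1, (hy v).2, sq]
  rfl

theorem mvfderiv_metricCoeff_warped (x : B × F) (u v w : TangentSpace (IB.prod IF) x) :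
    (fun y ↦ mvfderiv (IB.prod IF) (metricCoeff (warpedMetric gB gF f hf hpos) u v) y
        (coordField w y)) =ᶠ[𝓝 x] fun y ↦
      mvfderiv IB (metricCoeff gB (basePart IB IF x u) (basePart IB IF x v)) y.1
          (coordField (basePart IB IF x w) y.1)
        + 2 * f y.1 * mvfderiv IB f y.1 (coordField (basePart IB IF x w) y.1)
          * metricCoeff gF (fibrePart IB IF x u) (fibrePart IB IF x v) y.2
        + f y.1 ^ 2 * mvfderiv IF (metricCoeff gF (fibrePart IB IF x u) (fibrePart IB IF x v)) y.2
          (coordField (fibrePart IB IF x w) y.2) := by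
  filter_upwards [eventually_coordField_prod (IB := IB) (IF := IF) x,
    (metricCoeff_warped gB gF hf hpos x u v).eventuallyEq_nhds,
    continuousAt_fst.eventually
      (eventually_mdiffAt_metricCoeff gB (basePart IB IF x u) (basePart IB IF x v)),
    continuousAt_snd.eventually
      (eventually_mdiffAt_metricCoeff gF (fibrePart IB IF x u) (fibrePart IB IF x v))]
    with y hy hG hB hF
  have hfy : MDifferentiableAt IB 𝓘(ℝ, ℝ) f y.1 := (hf y.1).mdifferentiableAt (by simp)
  have hff : MDifferentiableAt IB 𝓘(ℝ, ℝ) (fun p ↦ f p * f p) y.1 := hfy.mul hfy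
  rw [mvfderiv_congr hG, mvfderiv_fst_add_mul hB hff hF, mvfderiv_fun_mul hfy hfy,
    (hy w).1, (hy w).2]
  simp only [add_apply, smul_apply, smul_eq_mul]
  ring

theorem christoffel_warped (x : B × F) (u v w : TangentSpace (IB.prod IF) x) :
    christoffel (warpedMetric gB gF f hf hpos) u v w =ᶠ[𝓝 x] fun y ↦
      christoffel gB (basePart IB IF x u) (basePart IB IF x v) (basePart IB IF x w) y.1
        + f y.1 * f y.1 * christoffel gF (fibrePart IB IF x u) (fibrePart IB IF x v)
          (fibrePart IB IF x w) y.2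
        + f y.1 * (mvfderiv IB f y.1 (coordField (basePart IB IF x u) y.1)
            * metricCoeff gF (fibrePart IB IF x v) (fibrePart IB IF x w) y.2
          + mvfderiv IB f y.1 (coordField (basePart IB IF x v) y.1)
            * metricCoeff gF (fibrePart IB IF x w) (fibrePart IB IF x u) y.2
          - mvfderiv IB f y.1 (coordField (basePart IB IF x w) y.1)
            * metricCoeff gF (fibrePart IB IF x u) (fibrePart IB IF x v) y.2) := by
  have hM := two_mul_christoffel_eventuallyEq (warpedMetric gB gF f hf hpos) u v w
  have hB := (continuousAt_fst (p := x)).eventually (two_mul_christoffel_eventuallyEq gB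
    (basePart IB IF x u) (basePart IB IF x v) (basePart IB IF x w))
  have hF := (continuousAt_snd (p := x)).eventually (two_mul_christoffel_eventuallyEq gF
    (fibrePart IB IF x u) (fibrePart IB IF x v) (fibrePart IB IF x w))
  filter_upwards [hM, hB, hF, mvfderiv_metricCoeff_warped gB gF hf hpos x v w u,
    mvfderiv_metricCoeff_warped gB gF hf hpos x w u v,
    mvfderiv_metricCoeff_warped gB gF hf hpos x u v w] with y hM hB hF h1 h2 h3
  rw [h1, h2, h3] at hM
  linear_combination (1 / 2) * hM - (1 / 2) * hB - (1 / 2) * f y.1 ^ 2 * hF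

/-- The Levi-Civita connection of a warped product in coordinate fields. -/
theorem leviCivita_warped (x : B × F) (u v : TangentSpace (IB.prod IF) x) :
    leviCivita (warpedMetric gB gF f hf hpos) (coordField v) x u
      = horizontal IB IF x (leviCivita gB (coordField (basePart IB IF x v)) x.1 (basePart IB IF x u)
          - (f x.1 * gF.inner x.2 (fibrePart IB IF x u) (fibrePart IB IF x v)) •
            riemannianGradient gB f x.1)
        + vertical IB IF x
          (leviCivita gF (coordField (fibrePart IB IF x v)) x.2 (fibrePart IB IF x u)
          + (mvfderiv IB f x.1 (basePart IB IF x u) / f x.1) • fibrePart IB IF x v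
          + (mvfderiv IB f x.1 (basePart IB IF x v) / f x.1) • fibrePart IB IF x u) := by
  have hfx := (hpos x.1).ne'
  refine inner_left_ext (warpedMetric gB gF f hf hpos) fun w ↦ ?_
  rw [← christoffel_self]
  refine (christoffel_warped gB gF hf hpos x u v w).self_of_nhds.trans ?_
  simp only [christoffel_self, warpedMetric_inner, metricCoeff_self, map_add, map_sub, map_smul, basePart_horizontal,
    fibrePart_horizontal, basePart_vertical, fibrePart_vertical, add_apply, sub_apply, smul_apply,
    smul_eq_mul, inner_gradient, FiberBundle.extend_apply_self, zero_add, map_zero,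
    zero_apply]
  rw [gF.symm x.2 (fibrePart IB IF x w)]
  field_simp
  ring

/-- Near `x`, points lie in the coordinate domains at `x.1` and `x.2`. -/
theorem eventually_mem_chartAt_prod (x : B × F) :
    ∀ᶠ y in 𝓝 x, y.1 ∈ (chartAt HB x.1).source ∧ y.2 ∈ (chartAt HF x.2).source :=
  (continuousAt_fst.eventually (eventually_mem_chartAt_source (H := HB) x.1)).and
    (continuousAt_snd.eventually (eventually_mem_chartAt_source (H := HF) x.2))

theorem mdiffAt_warping_mul_mvfderiv (p : B) (hf : ContMDiff IB 𝓘(ℝ) ∞ f) (X : TangentSpace IB p) :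
    MDifferentiableAt IB 𝓘(ℝ, ℝ) (fun q ↦ f q * mvfderiv IB f q (coordField X q)) p :=
  ((hf p).mul (contMDiffAt_mvfderiv_coordField (hf p) X)).mdifferentiableAt (by simp)

theorem mvfderiv_warping_mul_mvfderiv (p : B) (hf : ContMDiff IB 𝓘(ℝ) ∞ f)
    (X Y : TangentSpace IB p) :
    mvfderiv IB (fun q ↦ f q * mvfderiv IB f q (coordField Y q)) p X
      = mvfderiv IB f p X * mvfderiv IB f p Y
        + f p * (hessian gB f p X Y + mvfderiv IB f p (leviCivita gB (coordField Y) p X)) := by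
  rw [mvfderiv_fun_mul ((hf p).mdifferentiableAt (by simp))
    ((contMDiffAt_mvfderiv_coordField (hf p) Y).mdifferentiableAt (by simp))]
  simp only [add_apply, smul_apply, smul_eq_mul, hessian_eq gB, FiberBundle.extend_apply_self]
  ring

section
variable (x : B × F) (X Y Z : TangentSpace IB x.1) (V W Q : TangentSpace IF x.2)

theorem christoffel_hhh :
    christoffel (warpedMetric gB gF f hf hpos) (horizontal IB IF x X) (horizontal IB IF x Y)
      (horizontal IB IF x Z) =ᶠ[𝓝 x] fun y ↦ christoffel gB X Y Z y.1 := by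
  filter_upwards [christoffel_warped gB gF hf hpos x (horizontal IB IF x X) (horizontal IB IF x Y)
    (horizontal IB IF x Z), eventually_mem_chartAt_prod (HB := HB) (HF := HF) x] with y hy hs
  simp [hy, christoffel_zero_left gF hs.2, metricCoeff_zero_left gF hs.2]

theorem christoffel_hhv :
    christoffel (warpedMetric gB gF f hf hpos) (horizontal IB IF x X) (horizontal IB IF x Y)
      (vertical IB IF x V) =ᶠ[𝓝 x] fun _ ↦ 0 := by
  filter_upwards [christoffel_warped gB gF hf hpos x (horizontal IB IF x X) (horizontal IB IF x Y)
    (vertical IB IF x V), eventually_mem_chartAt_prod (HB := HB) (HF := HF) x] with y hy hs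
  simp [hy, christoffel_zero_right gB hs.1, christoffel_zero_left gF hs.2,
    metricCoeff_zero_left gF hs.2, metricCoeff_zero_right gF hs.2]

theorem christoffel_hvh :
    christoffel (warpedMetric gB gF f hf hpos) (horizontal IB IF x X) (vertical IB IF x V)
      (horizontal IB IF x Y) =ᶠ[𝓝 x] fun _ ↦ 0 := by
  filter_upwards [christoffel_warped gB gF hf hpos x (horizontal IB IF x X) (vertical IB IF x V)
    (horizontal IB IF x Y), eventually_mem_chartAt_prod (HB := HB) (HF := HF) x] with y hy hs
  simp [hy, christoffel_zero_mid gB hs.1, christoffel_zero_left gF hs.2,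
    metricCoeff_zero_left gF hs.2, metricCoeff_zero_right gF hs.2]

theorem christoffel_vhv :
    christoffel (warpedMetric gB gF f hf hpos) (vertical IB IF x V) (horizontal IB IF x X)
      (vertical IB IF x W) =ᶠ[𝓝 x]
        fun y ↦ f y.1 * mvfderiv IB f y.1 (coordField X y.1) * metricCoeff gF V W y.2 := by
  filter_upwards [christoffel_warped gB gF hf hpos x (vertical IB IF x V) (horizontal IB IF x X)
    (vertical IB IF x W), eventually_mem_chartAt_prod (HB := HB) (HF := HF) x] with y hy hs
  simp [hy, christoffel_zero_left gB hs.1, christoffel_zero_mid gF hs.2,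
    metricCoeff_zero_left gF hs.2, metricCoeff_zero_right gF hs.2, metricCoeff_symm gF W V]
  ring

theorem christoffel_vvh :
    christoffel (warpedMetric gB gF f hf hpos) (vertical IB IF x V) (vertical IB IF x W)
      (horizontal IB IF x X) =ᶠ[𝓝 x]
        fun y ↦ f y.1 * mvfderiv IB f y.1 (coordField X y.1) * (-metricCoeff gF V W y.2) := by
  filter_upwards [christoffel_warped gB gF hf hpos x (vertical IB IF x V) (vertical IB IF x W)
    (horizontal IB IF x X), eventually_mem_chartAt_prod (HB := HB) (HF := HF) x] with y hy hs
  simp [hy, christoffel_zero_left gB hs.1, christoffel_zero_right gF hs.2,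
    metricCoeff_zero_left gF hs.2, metricCoeff_zero_right gF hs.2]
  ring

theorem christoffel_vvv :
    christoffel (warpedMetric gB gF f hf hpos) (vertical IB IF x V) (vertical IB IF x W)
      (vertical IB IF x Q) =ᶠ[𝓝 x] fun y ↦ f y.1 * f y.1 * christoffel gF V W Q y.2 := by
  filter_upwards [christoffel_warped gB gF hf hpos x (vertical IB IF x V) (vertical IB IF x W)
    (vertical IB IF x Q), eventually_mem_chartAt_prod (HB := HB) (HF := HF) x] with y hy hs
  simp [hy, christoffel_zero_left gB hs.1, coordField_zero hs.1]

theorem leviCivita_hh :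
    leviCivita (warpedMetric gB gF f hf hpos) (coordField (horizontal IB IF x Y)) x
      (horizontal IB IF x X) = horizontal IB IF x (leviCivita gB (coordField Y) x.1 X) := by
  simp [leviCivita_warped]

theorem leviCivita_hv :
    leviCivita (warpedMetric gB gF f hf hpos) (coordField (vertical IB IF x V)) x
      (horizontal IB IF x X) = vertical IB IF x ((mvfderiv IB f x.1 X / f x.1) • V) := by
  simp [leviCivita_warped, leviCivita_coordField_zero gB (mem_chart_source HB x.1)]

theorem leviCivita_vh :
    leviCivita (warpedMetric gB gF f hf hpos) (coordField (horizontal IB IF x X)) x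
      (vertical IB IF x V) = vertical IB IF x ((mvfderiv IB f x.1 X / f x.1) • V) := by
  simp [leviCivita_warped, leviCivita_coordField_zero gF (mem_chart_source HF x.2)]

theorem leviCivita_vv :
    leviCivita (warpedMetric gB gF f hf hpos) (coordField (vertical IB IF x W)) x
      (vertical IB IF x V) = vertical IB IF x (leviCivita gF (coordField W) x.2 V)
        - horizontal IB IF x ((f x.1 * gF.inner x.2 V W) • riemannianGradient gB f x.1) := by
  simp [leviCivita_warped, leviCivita_coordField_zero gB (mem_chart_source HB x.1)]
  abel

theorem curvatureForm_hhhh (Z' : TangentSpace IB x.1) :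
    curvatureForm (warpedMetric gB gF f hf hpos) (horizontal IB IF x X) (horizontal IB IF x Z)
      (horizontal IB IF x Y) (horizontal IB IF x Z') = curvatureForm gB X Z Y Z' := by
  simp only [curvatureForm, mvfderiv_congr (christoffel_hhh gB gF hf hpos x _ _ _), leviCivita_hh,
    mvfderiv_comp_fst (mdiffAt_christoffel gB _ _ _), warpedMetric_inner, basePart_horizontal,
    fibrePart_horizontal, map_zero, mul_zero, add_zero]

theorem curvatureForm_hvhv :
    curvatureForm (warpedMetric gB gF f hf hpos) (horizontal IB IF x X) (vertical IB IF x V)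
      (horizontal IB IF x Y) (vertical IB IF x W)
      = f x.1 * gF.inner x.2 V W * hessian gB f x.1 X Y := by
  have hfx := (hpos x.1).ne'
  have h1 := mvfderiv_fst_mul (mdiffAt_warping_mul_mvfderiv x.1 hf Y) (mdiffAt_metricCoeff gF V W)
    (horizontal IB IF x X)
  simp only [curvatureForm, mvfderiv_congr (christoffel_vhv gB gF hf hpos x _ _ _),
    mvfderiv_congr (christoffel_hhv gB gF hf hpos x _ _ _), leviCivita_hh, leviCivita_hv,
    leviCivita_vh, leviCivita_vv, h1, mvfderiv_const, warpedMetric_inner]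
  simp [mvfderiv_warping_mul_mvfderiv gB x.1 hf, metricCoeff_self, gB.symm x.1 _ (riemannianGradient gB f x.1), inner_gradient]
  field_simp
  ring

theorem curvatureForm_vhvh :
    curvatureForm (warpedMetric gB gF f hf hpos) (vertical IB IF x V) (horizontal IB IF x X)
      (vertical IB IF x W) (horizontal IB IF x Y)
      = f x.1 * gF.inner x.2 V W * hessian gB f x.1 X Y := by
  have hfx := (hpos x.1).ne'
  have h1 := mvfderiv_fst_mul (mdiffAt_warping_mul_mvfderiv x.1 hf Y)
    (mdiffAt_metricCoeff gF V W).neg (horizontal IB IF x X)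
  simp only [Pi.neg_apply] at h1
  simp only [curvatureForm, mvfderiv_congr (christoffel_vvh gB gF hf hpos x _ _ _),
    mvfderiv_congr (christoffel_hvh gB gF hf hpos x _ _ _), leviCivita_hh, leviCivita_hv,
    leviCivita_vh, leviCivita_vv, h1, mvfderiv_const, warpedMetric_inner]
  simp [mvfderiv_warping_mul_mvfderiv gB x.1 hf, metricCoeff_self, inner_gradient, gF.symm x.2 W V]
  field_simp
  ring

theorem curvatureForm_vvvv (Q' : TangentSpace IF x.2) :
    curvatureForm (warpedMetric gB gF f hf hpos) (vertical IB IF x V) (vertical IB IF x Q)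
      (vertical IB IF x W) (vertical IB IF x Q')
      = f x.1 ^ 2 * (curvatureForm gF V Q W Q'
        + gB.inner x.1 (riemannianGradient gB f x.1) (riemannianGradient gB f x.1)
          * (gF.inner x.2 V W * gF.inner x.2 Q Q' - gF.inner x.2 Q W * gF.inner x.2 V Q')) := by
  have hff : MDifferentiableAt IB 𝓘(ℝ, ℝ) (fun p ↦ f p * f p) x.1 :=
    ((hf x.1).mul (hf x.1)).mdifferentiableAt (by simp)
  simp only [curvatureForm, mvfderiv_congr (christoffel_vvv gB gF hf hpos x _ _ _),
    mvfderiv_fst_mul hff (mdiffAt_christoffel gF _ _ _), leviCivita_vv, warpedMetric_inner]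
  simp
  ring

theorem mdiffAt_liftBase {P : Π p : B, TangentSpace IB p} {x : B × F}
    (hP : MDiffAt (T% P) x.1) : MDiffAt (T% (liftBase (IF := IF) (F := F) P)) x := by
  have h1 : MDifferentiableAt (IB.prod IF) (IB.tangent.prod IF.tangent)
      (fun y : B × F ↦ ((⟨y.1, P y.1⟩ : TangentBundle IB B), (⟨y.2, 0⟩ : TangentBundle IF F))) x :=
    (MDifferentiableAt.comp x hP mdifferentiableAt_fst).prodMk
      (MDifferentiableAt.comp x (mdifferentiableAt_zeroSection ℝ (TangentSpace IF : F → Type _))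
        mdifferentiableAt_snd)
  exact MDifferentiableAt.comp x
    ((contMDiff_equivTangentBundleProd_symm (n := 1)).mdifferentiable one_ne_zero _) h1

/-- Horizontal lifts of a `g_B`-orthonormal basis and rescaled vertical lifts of a
`g_F`-orthonormal basis form an orthonormal frame of the warped product. -/
theorem warped_frame_sum (w : TangentSpace (IB.prod IF) x) :
    ∑ i, (warpedMetric gB gF f hf hpos).inner x w
        (Sum.elim (fun i ↦ horizontal IB IF x (onb gB x.1 i))
          (fun j ↦ vertical IB IF x ((f x.1)⁻¹ • onb gF x.2 j)) i) •
        Sum.elim (fun i ↦ horizontal IB IF x (onb gB x.1 i))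
          (fun j ↦ vertical IB IF x ((f x.1)⁻¹ • onb gF x.2 j)) i = w := by
  have hfx := (hpos x.1).ne'
  rw [Fintype.sum_sum_type]
  have h1 := congrArg (horizontal IB IF x) (onb_sum gB x.1 (basePart IB IF x w))
  have h2 := congrArg (vertical IB IF x) (onb_sum gF x.2 (fibrePart IB IF x w))
  have h3 : horizontal IB IF x (basePart IB IF x w) + vertical IB IF x (fibrePart IB IF x w) = w :=
    Prod.ext (add_zero _) (zero_add _)
  conv_rhs => rw [← h3, ← h1, ← h2]
  simp only [map_sum, map_smul]
  congr 1
  · refine Finset.sum_congr rfl fun i _ ↦ ?_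
    simp [warpedMetric_inner]
  · refine Finset.sum_congr rfl fun i _ ↦ ?_
    simp only [warpedMetric_inner, Sum.elim_inr, basePart_vertical, fibrePart_vertical, map_zero,
      map_smul, smul_smul, smul_eq_mul]
    congr 1
    field_simp
    ring

theorem ricci_warped_horizontal :
    ricci (warpedMetric gB gF f hf hpos) (leviCivita (warpedMetric gB gF f hf hpos)) x
      (horizontal IB IF x X) (horizontal IB IF x Y)
      = ricci gB (leviCivita gB) x.1 X Y
        + Module.finrank ℝ EF * (hessian gB f x.1 X Y / f x.1) := by
  have hfx := (hpos x.1).ne'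
  rw [ricci_leviCivita _ x _ _ _ (warped_frame_sum gB gF hf hpos x), Fintype.sum_sum_type,
    ricci_leviCivita gB x.1 X Y _ (onb_sum gB x.1)]
  have h2 : ∀ j, curvatureForm (warpedMetric gB gF f hf hpos) (horizontal IB IF x X)
      (vertical IB IF x ((f x.1)⁻¹ • onb gF x.2 j)) (horizontal IB IF x Y)
      (vertical IB IF x ((f x.1)⁻¹ • onb gF x.2 j)) = hessian gB f x.1 X Y / f x.1 := by
    intro j
    rw [curvatureForm_hvhv]
    simp only [map_smul, smul_apply, onb_inner, if_true, smul_eq_mul]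
    field_simp
  simp only [Sum.elim_inl, Sum.elim_inr, curvatureForm_hhhh, h2, Finset.sum_const,
    Finset.card_univ, Fintype.card_fin, nsmul_eq_mul]

theorem ricci_warped_vertical :
    ricci (warpedMetric gB gF f hf hpos) (leviCivita (warpedMetric gB gF f hf hpos)) x
      (vertical IB IF x V) (vertical IB IF x W)
      = ricci gF (leviCivita gF) x.2 V W
        + gF.inner x.2 V W * (-(f x.1 * laplacian gB f x.1) + (Module.finrank ℝ EF - 1)
          * gB.inner x.1 (riemannianGradient gB f x.1) (riemannianGradient gB f x.1)) := by
  have hfx := (hpos x.1).ne'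
  have hs : ∀ j, curvatureForm gF V ((f x.1)⁻¹ • onb gF x.2 j) W ((f x.1)⁻¹ • onb gF x.2 j)
      = (f x.1)⁻¹ * (f x.1)⁻¹ * curvatureForm gF V (onb gF x.2 j) W (onb gF x.2 j) := by
    intro j
    change curvatureBilin gF V W ((f x.1)⁻¹ • onb gF x.2 j) ((f x.1)⁻¹ • onb gF x.2 j)
      = (f x.1)⁻¹ * (f x.1)⁻¹ * curvatureBilin gF V W (onb gF x.2 j) (onb gF x.2 j)
    simp only [map_smul, LinearMap.smul_apply, smul_eq_mul, mul_assoc]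
  have htr : ∑ j, gF.inner x.2 (onb gF x.2 j) W * gF.inner x.2 V (onb gF x.2 j)
      = gF.inner x.2 V W := by
    conv_rhs => rw [← onb_sum gF x.2 V]
    simp [mul_comm]
  rw [ricci_leviCivita _ x _ _ _ (warped_frame_sum gB gF hf hpos x), Fintype.sum_sum_type,
    ricci_leviCivita gF x.2 V W _ (onb_sum gF x.2)]
  have h2 : ∀ j, curvatureForm (warpedMetric gB gF f hf hpos) (vertical IB IF x V)
      (vertical IB IF x ((f x.1)⁻¹ • onb gF x.2 j)) (vertical IB IF x W)
      (vertical IB IF x ((f x.1)⁻¹ • onb gF x.2 j))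
      = curvatureForm gF V (onb gF x.2 j) W (onb gF x.2 j)
        + gB.inner x.1 (riemannianGradient gB f x.1) (riemannianGradient gB f x.1)
          * (gF.inner x.2 V W - gF.inner x.2 (onb gF x.2 j) W * gF.inner x.2 V (onb gF x.2 j)) := by
    intro j
    rw [curvatureForm_vvvv, hs]
    simp only [map_smul, smul_apply, onb_inner, if_true, smul_eq_mul]
    field_simp
  simp only [Sum.elim_inl, Sum.elim_inr, curvatureForm_vhvh, h2, Finset.sum_add_distrib,
    ← Finset.mul_sum, Finset.sum_sub_distrib, htr, laplacian, Finset.sum_const, Finset.card_univ,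
    Fintype.card_fin, nsmul_eq_mul]
  ring

theorem semiSymmetricTensor_horizontal {P : Π p : B, TangentSpace IB p}
    (hP : MDiffAt (T% P) x.1) :
    semiSymmetricTensor (warpedMetric gB gF f hf hpos) (liftBase P) (horizontal IB IF x X)
      (horizontal IB IF x Y) = semiSymmetricTensor gB P X Y := by
  have hev : (fun y ↦ (warpedMetric gB gF f hf hpos).inner y
      (coordField (horizontal IB IF x Y) y) (liftBase P y)) =ᶠ[𝓝 x]
      fun y ↦ gB.inner y.1 (coordField Y y.1) (P y.1) := by
    filter_upwards [eventually_coordField_prod (IB := IB) (IF := IF) x] with y hy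
    simp [warpedMetric_inner, (hy (horizontal IB IF x Y)).1, liftBase]
  have h1 := leviCivita_metric (warpedMetric gB gF f hf hpos)
    (mdiffAt_coordField (horizontal IB IF x X)) (mdiffAt_coordField (horizontal IB IF x Y))
    (mdiffAt_liftBase hP)
  have h2 := leviCivita_metric gB (mdiffAt_coordField X) (mdiffAt_coordField Y) hP
  rw [mvfderiv_congr hev, mvfderiv_comp_fst (mdiff_inner gB (mdiffAt_coordField Y) hP)] at h1
  simp only [FiberBundle.extend_apply_self, basePart_horizontal, leviCivita_hh] at h1 h2
  rw [h2] at h1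
  simp only [semiSymmetricTensor]
  simp [warpedMetric_inner, liftBase] at h1 ⊢
  linarith

theorem semiSymmetricTensor_vertical {P : Π p : B, TangentSpace IB p}
    (hP : MDiffAt (T% P) x.1) :
    semiSymmetricTensor (warpedMetric gB gF f hf hpos) (liftBase P) (vertical IB IF x V)
      (vertical IB IF x W) = f x.1 * mvfderiv IB f x.1 (P x.1) * gF.inner x.2 V W := by
  have hev : (fun y ↦ (warpedMetric gB gF f hf hpos).inner y
      (coordField (vertical IB IF x W) y) (liftBase P y)) =ᶠ[𝓝 x] fun _ ↦ 0 := by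
    filter_upwards [eventually_coordField_prod (IB := IB) (IF := IF) x,
      eventually_mem_chartAt_prod (HB := HB) (HF := HF) x] with y hy hs
    simp [warpedMetric_inner, (hy (vertical IB IF x W)).1, liftBase, coordField_zero hs.1]
  have h1 := leviCivita_metric (warpedMetric gB gF f hf hpos)
    (mdiffAt_coordField (vertical IB IF x V)) (mdiffAt_coordField (vertical IB IF x W))
    (mdiffAt_liftBase hP)
  rw [mvfderiv_congr hev, mvfderiv_const] at h1
  simp only [FiberBundle.extend_apply_self, leviCivita_vv] at h1
  simp only [semiSymmetricTensor]
  simp [warpedMetric_inner, liftBase, inner_gradient] at h1 ⊢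
  linarith

end

end Warped

end

end WarpedGeometry

open WarpedGeometry

theorem proposition3p1
    {EB : Type*} [NormedAddCommGroup EB] [NormedSpace ℝ EB] [FiniteDimensional ℝ EB]
    {HB : Type*} [TopologicalSpace HB] {IB : ModelWithCorners ℝ EB HB} [IB.Boundaryless]
    {B : Type*} [TopologicalSpace B] [ChartedSpace HB B] [IsManifold IB ∞ B]
    {EF : Type*} [NormedAddCommGroup EF] [NormedSpace ℝ EF] [FiniteDimensional ℝ EF]
    {HF : Type*} [TopologicalSpace HF] {IF : ModelWithCorners ℝ EF HF} [IF.Boundaryless]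
    {F : Type*} [TopologicalSpace F] [ChartedSpace HF F] [IsManifold IF ∞ F]
    (gB : SmoothMetric IB B) (gF : SmoothMetric IF F)
    (f : B → ℝ) (hf : ContMDiff IB 𝓘(ℝ, ℝ) ∞ f) (hpos : ∀ p, 0 < f p)
    (n₁ n₂ : ℕ) (hn₁ : Module.finrank ℝ EB = n₁) (hn₂ : Module.finrank ℝ EF = n₂)
    -- the vector field `P` on the base, lifted to the product
    (P : Π p : B, TangentSpace IB p)
    (hP : ContMDiff IB (IB.prod 𝓘(ℝ, EB)) ∞ (fun p ↦ Bundle.TotalSpace.mk' EB p (P p)))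
    -- the warped product is quasi-Einstein with scalars `a`, `b` and generator `U`
    (a b : ℝ) (U : Π x : B × F, TangentSpace (IB.prod IF) x)
    (hU : IsQuasiEinstein (warpedMetric gB gF f hf hpos)
      (semiSymmetricConnection (warpedMetric gB gF f hf hpos) (liftBase P)) a b U) :
    -- On `F`, the connection is associated with the `F`-component of `P`, which is zero.
    -- first case: `U` is tangent to the base
    ((∀ x, fibrePart IB IF x (U x) = 0) →
      ∀ (x : B × F) (X Y : TangentSpace IB x.1) (V W : TangentSpace IF x.2),
        ricci gB (semiSymmetricConnection gB P) x.1 X Y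
          = a * gB.inner x.1 X Y
            - n₂ * (hessian gB f x.1 X Y / f x.1
                + (warpedMetric gB gF f hf hpos).inner x (horizontal IB IF x Y)
                    (leviCivita (warpedMetric gB gF f hf hpos) (liftBase P) x
                      (horizontal IB IF x X))
                - (warpedMetric gB gF f hf hpos).inner x (horizontal IB IF x X) (liftBase P x)
                  * (warpedMetric gB gF f hf hpos).inner x (horizontal IB IF x Y) (liftBase P x))
            + b * gB.inner x.1 X (basePart IB IF x (U x))
                * gB.inner x.1 Y (basePart IB IF x (U x))
        ∧ ricci gF (semiSymmetricConnection gF 0) x.2 V W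
          = gF.inner x.2 V W
            * (f x.1 * laplacian gB f x.1
              + (1 - n₂) * gB.inner x.1 (riemannianGradient gB f x.1) (riemannianGradient gB f x.1)
              + (1 - (n₁ + n₂)) * f x.1 * mvfderiv IB f x.1 (P x.1)
              + a * f x.1 ^ 2)) ∧
    -- second case: `U` is tangent to the fibre
    ((∀ x, basePart IB IF x (U x) = 0) →
      ∀ (x : B × F) (X Y : TangentSpace IB x.1) (V W : TangentSpace IF x.2),
        ricci gB (semiSymmetricConnection gB P) x.1 X Y
          = a * gB.inner x.1 X Y
            - n₂ * (hessian gB f x.1 X Y / f x.1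
                + (warpedMetric gB gF f hf hpos).inner x (horizontal IB IF x Y)
                    (leviCivita (warpedMetric gB gF f hf hpos) (liftBase P) x
                      (horizontal IB IF x X))
                - (warpedMetric gB gF f hf hpos).inner x (horizontal IB IF x X) (liftBase P x)
                  * (warpedMetric gB gF f hf hpos).inner x (horizontal IB IF x Y) (liftBase P x))
        ∧ ricci gF (semiSymmetricConnection gF 0) x.2 V W
          = gF.inner x.2 V W
            * (f x.1 * laplacian gB f x.1
              + (1 - n₂) * gB.inner x.1 (riemannianGradient gB f x.1) (riemannianGradient gB f x.1)
              + (1 - (n₁ + n₂)) * f x.1 * mvfderiv IB f x.1 (P x.1)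
              + a * f x.1 ^ 2)
            + b * f x.1 ^ 4 * gF.inner x.2 V (fibrePart IB IF x (U x))
                * gF.inner x.2 W (fibrePart IB IF x (U x))) := by 
  have hP' (p : B) : MDiffAt (T% P) p := (hP p).mdifferentiableAt (by simp)
  have hdim : (Module.finrank ℝ (EB × EF) : ℝ) = n₁ + n₂ := by
    rw [Module.finrank_prod, hn₁, hn₂, Nat.cast_add]
  have hB (x : B × F) (X Y : TangentSpace IB x.1) :
      ricci gB (semiSymmetricConnection gB P) x.1 X Y
        = a * gB.inner x.1 X Y
          - n₂ * (hessian gB f x.1 X Y / f x.1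
              + semiSymmetricTensor (warpedMetric gB gF f hf hpos) (liftBase P)
                (horizontal IB IF x X) (horizontal IB IF x Y))
          + b * gB.inner x.1 X (basePart IB IF x (U x))
              * gB.inner x.1 Y (basePart IB IF x (U x)) := by
    have h := hU.ricci_eq x (horizontal IB IF x X) (horizontal IB IF x Y)
    rw [ricci_semiSymmetricConnection _ (mdiffAt_liftBase (hP' x.1)), ricci_warped_horizontal,
      hdim, hn₂] at h
    rw [ricci_semiSymmetricConnection gB (hP' x.1), hn₁]
    rw [semiSymmetricTensor_horizontal gB gF hf hpos x X Y (hP' x.1)] at h ⊢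
    simp only [warpedMetric_inner, basePart_horizontal, fibrePart_horizontal, map_zero,
      zero_apply, mul_zero, add_zero] at h
    linear_combination h
  have hF (x : B × F) (V W : TangentSpace IF x.2) :
      ricci gF (semiSymmetricConnection gF 0) x.2 V W
        = gF.inner x.2 V W
          * (f x.1 * laplacian gB f x.1
            + (1 - n₂) * gB.inner x.1 (riemannianGradient gB f x.1) (riemannianGradient gB f x.1)
            + (1 - (n₁ + n₂)) * f x.1 * mvfderiv IB f x.1 (P x.1)
            + a * f x.1 ^ 2)
          + b * f x.1 ^ 4 * gF.inner x.2 V (fibrePart IB IF x (U x))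
              * gF.inner x.2 W (fibrePart IB IF x (U x)) := by
    have h := hU.ricci_eq x (vertical IB IF x V) (vertical IB IF x W)
    rw [ricci_semiSymmetricConnection _ (mdiffAt_liftBase (hP' x.1)), ricci_warped_vertical,
      semiSymmetricTensor_vertical gB gF hf hpos x V W (hP' x.1), hdim, hn₂] at h
    rw [ricci_semiSymmetricConnection gF (P := 0)
      (Bundle.mdifferentiableAt_zeroSection ..), semiSymmetricTensor_zero]
    simp only [warpedMetric_inner, basePart_vertical, fibrePart_vertical, map_zero,
      zero_apply, zero_add] at h
    linear_combination h
  refine ⟨fun hfib x X Y V W ↦ ⟨?_, ?_⟩, fun hbase x X Y V W ↦ ⟨?_, ?_⟩⟩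
  · rw [hB, semiSymmetricTensor, add_sub_assoc]
  · rw [hF, hfib, map_zero, mul_zero, zero_mul, add_zero]
  · rw [hB, hbase, map_zero, mul_zero, zero_mul, add_zero, semiSymmetricTensor, add_sub_assoc]
  · exact hF x V W
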